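/- Let $0\le k\le m$ be integers. A (smooth) self-shrinker is a connected, isometrically immersed hypersurface $x\colon\Sigma^m\to\mathbb{R}^{m+1}$ whose mean curvature vector $\mathbf{H}=\operatorname{tr}\mathbf{A}$, where $\mathbf{A}(X,Y)=(D_X\,dx(Y))^{\perp}$ is the second fundamental form, satisfies $x^{\perp}=-\mathbf{H}$; here $(\cdot)^{\perp}$ is the projection onto the normal bundle of $\Sigma$. Write $\mathbb{R}^{m+1}=\mathbb{R}^{k+1}\times\mathbb{R}^{m-k}\ni(y,z)$ and $\mathcal{C}^{k,m-k}_R=\mathbb{S}^k_R\times\mathbb{R}^{m-k}=\{|y|=R\}$. Let $D$ be the closed solid cylinder $\{|y|\le R\}$ bounded by $\mathcal{C}^{k,m-k}_R$; in the degenerate case $k=0$, $R=0$, where $\mathcal{C}^{0,m}_0$ is the hyperplane $\{y=0\}$, $D$ may also be either of the closed half-spaces $\{y\ge0\}$, $\{y\le0\}$ bounded by it. Let $x\colon\Sigma^m\to\mathbb{R}^{m+1}$ be a complete self-shrinker with $|\mathbf{H}|\le\sqrt{k}$ on $\Sigma$ and $x(\Sigma)\subseteq D$. If $x(\Sigma)\cap\mathcal{C}^{k,m-k}_R\neq\emptyset$,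 then (a) $R=\sqrt{k}$; (b) $x\colon\Sigma\to\mathcal{C}^{k,m-k}_{\sqrt{k}}$ is a Riemannian covering map (a surjective covering map that is an isometric local diffeomorphism). In particular, if $k\ge2$, then $\Sigma=\mathcal{C}^{k,m-k}_{\sqrt{k}}$ in the Riemannian sense, i.e. $x$ is an isometric diffeomorphism of $\Sigma$ onto $\mathcal{C}^{k,m-k}_{\sqrt{k}}$. -/

import Mathlib

open scoped Manifold ContDiff Bundle

namespace SelfShrinker

/-- The Euclidean space `ℝ^n`. -/
abbrev Euc (n : ℕ) : Type := EuclideanSpace ℝ (Fin n)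

section Hypersurface

variable {m : ℕ} {S : Type*} [TopologicalSpace S] [ChartedSpace (Euc m) S]

/-- The differential `dx_p : T_p S → ℝ^{m+1}` of a map `x : S → ℝ^{m+1}`. -/
noncomputable def differential (x : S → Euc (m + 1)) (p : S) :
    TangentSpace (𝓡 m) p →L[ℝ] Euc (m + 1) :=
  mfderiv (𝓡 m) 𝓘(ℝ, Euc (m + 1)) x p

/-- The normal space of `x` at `p`: the orthogonal complement of `dx_p (T_p S)`. -/
noncomputable def normalSpace (x : S → Euc (m + 1)) (p : S) : Submodule ℝ (Euc (m + 1)) :=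
  (LinearMap.range (differential x p : TangentSpace (𝓡 m) p →ₗ[ℝ] Euc (m + 1)))ᗮ

/-- The projection `w ↦ w^⊥` onto the normal space of `x` at `p`. -/
noncomputable def normalPart (x : S → Euc (m + 1)) (p : S) (w : Euc (m + 1)) : Euc (m + 1) :=
  (normalSpace x p).starProjection w

/-- The second fundamental form `A = D dx` at `p`, that is `A(v, w) = (D_V (dx W))^⊥` for any
vector fields `V, W` extending `v, w`. It is computed in the chart at `p` (through which Mathlib
identifies `T_p S` with `ℝ^m`), for the fields with constant coefficients: `A(v, w)` is the normal
part of the second derivative of `x` read in the chart. Another chart changes the second derivative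
by a tangential vector only. -/
noncomputable def secondFundamentalForm (x : S → Euc (m + 1)) (p : S)
    (v w : TangentSpace (𝓡 m) p) : Euc (m + 1) :=
  normalPart x p
    (fderiv ℝ (fderiv ℝ (x ∘ (extChartAt (𝓡 m) p).symm)) (extChartAt (𝓡 m) p p)
      (v : Euc m) (w : Euc m))

variable [Bundle.RiemannianBundle (fun p : S ↦ TangentSpace (𝓡 m) p)]

/-- The mean curvature vector `H = tr A`, the trace being taken with respect to the Riemannian
metric of `S`, over an orthonormal basis of `T_p S`. -/
noncomputable def meanCurvature (x : S → Euc (m + 1)) (p : S) : Euc (m + 1) :=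
  haveI : FiniteDimensional ℝ (TangentSpace (𝓡 m) p) :=
    inferInstanceAs (FiniteDimensional ℝ (Euc m))
  ∑ i, secondFundamentalForm x p (stdOrthonormalBasis ℝ (TangentSpace (𝓡 m) p) i)
    (stdOrthonormalBasis ℝ (TangentSpace (𝓡 m) p) i)

/-- `x : S → ℝ^{m+1}` is a smooth isometric immersion of the Riemannian manifold `S`. -/
structure IsIsometricImmersion (x : S → Euc (m + 1)) : Prop where
  smooth : ContMDiff (𝓡 m) 𝓘(ℝ, Euc (m + 1)) ∞ x
  isometric : ∀ (p : S) (v w : TangentSpace (𝓡 m) p),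
    inner ℝ (differential x p v) (differential x p w) = inner ℝ v w

/-- A self-shrinker (based at `0`): a connected, isometrically immersed hypersurface with
`x^⊥ = -H`. -/
structure IsSelfShrinker (x : S → Euc (m + 1)) : Prop where
  connected : ConnectedSpace S
  immersion : IsIsometricImmersion x
  equation : ∀ p, normalPart x p (x p) = -meanCurvature x p

/-- `x`, regarded as a map onto the embedded submanifold `C ⊆ ℝ^{m+1}` (with the metric induced by
`ℝ^{m+1}`), is a Riemannian covering map: a surjective topological covering map which is an
isometric local diffeomorphism. The local inverses, defined on relatively open subsets of `C`, are
smooth as maps on a subset of `ℝ^{m+1}`. -/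
structure IsRiemannianCovering (x : S → Euc (m + 1)) (C : Set (Euc (m + 1))) : Prop where
  immersion : IsIsometricImmersion x
  range_eq : Set.range x = C
  covering : IsCoveringMap
    (Set.codRestrict x C fun p ↦ range_eq ▸ Set.mem_range_self p)
  local_diffeo : ∀ p : S, ∃ U : Set S, IsOpen U ∧ p ∈ U ∧
    (∃ V : Set (Euc (m + 1)), IsOpen V ∧ x '' U = V ∩ C) ∧
    ∃ s : Euc (m + 1) → S, ContMDiffOn 𝓘(ℝ, Euc (m + 1)) (𝓡 m) ∞ s (x '' U) ∧
      Set.LeftInvOn s x U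

/-- `x`, regarded as a map onto the embedded submanifold `C ⊆ ℝ^{m+1}` (with the metric induced by
`ℝ^{m+1}`), is an isometric diffeomorphism. -/
structure IsRiemannianIsometry (x : S → Euc (m + 1)) (C : Set (Euc (m + 1))) : Prop where
  immersion : IsIsometricImmersion x
  range_eq : Set.range x = C
  smooth_inverse : ∃ s : Euc (m + 1) → S,
    ContMDiffOn 𝓘(ℝ, Euc (m + 1)) (𝓡 m) ∞ s C ∧ Function.LeftInverse s x

end Hypersurface

section Cylinder

variable {m : ℕ}

/-- The distance `|y|` of `(y, z) ∈ ℝ^{k+1} × ℝ^{m-k} = ℝ^{m+1}` to the axis `{0} × ℝ^{m-k}`. -/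
noncomputable def axisDist (k : ℕ) (u : Euc (m + 1)) : ℝ :=
  √(∑ i ∈ Finset.univ.filter (fun i : Fin (m + 1) ↦ (i : ℕ) ≤ k), u i ^ 2)

/-- The cylinder `S^k_R × ℝ^{m-k} ⊆ ℝ^{m+1}`. -/
def cylinder (m k : ℕ) (R : ℝ) : Set (Euc (m + 1)) := {u | axisDist k u = R}

/-- `D` is a closed solid cylinder bounded by `S^k_R × ℝ^{m-k}`, i.e. `{|y| ≤ R}`. In the degenerate
case `k = 0`, `R = 0`, where `S^k_R × ℝ^{m-k}` is the hyperplane `{0} × ℝ^m`, the two closed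
half-spaces bounded by this hyperplane are allowed as well. -/
def IsSolidCylinder (k : ℕ) (R : ℝ) (D : Set (Euc (m + 1))) : Prop :=
  D = {u | axisDist k u ≤ R} ∨
    (k = 0 ∧ R = 0 ∧ (D = {u | 0 ≤ u 0} ∨ D = {u | u 0 ≤ 0}))

end Cylinder

end SelfShrinker

/-! Let `F` be a function on `ℝ^{m+1}` with gradient `f` and Hessian `B`. On a self-shrinker the
equation `x^⊥ = -H` gives the drift Laplacian (Laplacian minus derivative along the tangential part
of `x`) of `F ∘ x` the purely ambient form `∑ ⟨B e_i, e_i⟩ - ⟨f, x⟩`, summed over an orthonormal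
tangent frame. No intrinsic Laplacian has to be defined: only the sign of this expression at a local
maximum is needed (`IsSelfShrinker.sum_hessian_le_of_isLocalMax`).

For `F = |y|²` the expression is at least `2k - 2|y|²`, because the projection to the `y`-space has
trace at least `k` on every hyperplane (`le_sum_inner_axisProj`). At a touching point `F ∘ x` is
maximal, so `k ≤ R²`. There `y` is also normal, so `R² = ⟨y, x^⊥⟩ = -⟨y, H⟩ ≤ R√k`, and hence `R =
√k`. Now `|y|² ≤ k` makes `F ∘ x` a subsolution that attains its maximum, and the strong maximum
principle (`IsSelfShrinker.eq_of_isMax`) puts all of `x(S)` on the cylinder. In the half-space case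
a linear function replaces `|y|²`. The maximum principle is Hopf's argument with a Gaussian barrier
living in the ambient space.

An isometric immersion into the cylinder, which has the same dimension, is a local diffeomorphism
(`IsIsometricImmersion.exists_local_inverse`) and is locally expanding up to a factor `2`.
Completeness then lifts Lipschitz paths (`exists_path_lift`). The points not antipodal to `c`
contract to `c` along radially projected segments; lifting these paths trivialises the map over that
open set and also gives surjectivity. For `k ≥ 2`, two such open sets, centred at antipodal points,
cover the cylinder and have connected intersection. Local sections therefore glue to a global one
(`injective_of_sections`), and the map is injective without any appeal to fundamental groups. -/

namespace SelfShrinker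

/-! ### The immersion read in a chart -/

section LocalRepresentation

open Set Filter Topology

variable {m : ℕ} {S : Type*} [TopologicalSpace S] [ChartedSpace (Euc m) S]

/-- The map `x` read in the preferred chart at `p`. -/
noncomputable def localRep (x : S → Euc (m + 1)) (p : S) : Euc m → Euc (m + 1) :=
  x ∘ (extChartAt (𝓡 m) p).symm

theorem localRep_apply (x : S → Euc (m + 1)) (p : S) (a : Euc m) :
    localRep x p a = x ((extChartAt (𝓡 m) p).symm a) := rfl

theorem localRep_base (x : S → Euc (m + 1)) (p : S) :
    localRep x p (extChartAt (𝓡 m) p p) = x p := by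
  simp [localRep]

theorem contDiffOn_localRep [IsManifold (𝓡 m) ∞ S] {x : S → Euc (m + 1)}
    (hx : ContMDiff (𝓡 m) 𝓘(ℝ, Euc (m + 1)) ∞ x) (p : S) :
    ContDiffOn ℝ ∞ (localRep x p) (extChartAt (𝓡 m) p).target := by
  rw [← contMDiffOn_iff_contDiffOn]
  exact hx.comp_contMDiffOn (contMDiffOn_extChartAt_symm p)

theorem contDiffAt_localRep [IsManifold (𝓡 m) ∞ S] {x : S → Euc (m + 1)}
    (hx : ContMDiff (𝓡 m) 𝓘(ℝ, Euc (m + 1)) ∞ x) (p : S) {a : Euc m}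
    (ha : a ∈ (extChartAt (𝓡 m) p).target) : ContDiffAt ℝ ∞ (localRep x p) a :=
  (contDiffOn_localRep hx p).contDiffAt ((isOpen_extChartAt_target p).mem_nhds ha)

theorem differential_eq_fderiv_localRep [IsManifold (𝓡 m) ∞ S] {x : S → Euc (m + 1)}
    (hx : ContMDiff (𝓡 m) 𝓘(ℝ, Euc (m + 1)) ∞ x) (p : S) (v : Euc m) :
    differential x p v = fderiv ℝ (localRep x p) (extChartAt (𝓡 m) p p) v := by
  have h : MDifferentiableAt (𝓡 m) 𝓘(ℝ, Euc (m + 1)) x p :=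
    (hx p).mdifferentiableAt (by simp)
  have h2 : fderivWithin ℝ (writtenInExtChartAt (𝓡 m) 𝓘(ℝ, Euc (m + 1)) p x) (range (𝓡 m))
      (extChartAt (𝓡 m) p p) = fderiv ℝ (localRep x p) (extChartAt (𝓡 m) p p) := by
    simp only [modelWithCornersSelf_coe, range_id, fderivWithin_univ]
    rfl
  exact (congr($h.mfderiv v)).trans congr($h2 v)

/-- Away from the base point of the chart, this is what lets the isometry condition be applied to
chart derivatives. -/
theorem fderiv_localRep_apply [IsManifold (𝓡 m) ∞ S] {x : S → Euc (m + 1)}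
    (hx : ContMDiff (𝓡 m) 𝓘(ℝ, Euc (m + 1)) ∞ x) (p : S) {a : Euc m}
    (ha : a ∈ (extChartAt (𝓡 m) p).target) (v : Euc m) :
    fderiv ℝ (localRep x p) a v = differential x ((extChartAt (𝓡 m) p).symm a)
      (mfderiv 𝓘(ℝ, Euc m) (𝓡 m) (extChartAt (𝓡 m) p).symm a v) := by
  have h1 : MDifferentiableAt (𝓡 m) 𝓘(ℝ, Euc (m + 1)) x ((extChartAt (𝓡 m) p).symm a) :=
    (hx _).mdifferentiableAt (by simp)
  have h2 : MDifferentiableAt 𝓘(ℝ, Euc m) (𝓡 m) (extChartAt (𝓡 m) p).symm a := by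
    have := (contMDiffOn_extChartAt_symm (n := ∞) (I := 𝓡 m) p)
    exact (this.contMDiffAt ((isOpen_extChartAt_target p).mem_nhds ha)).mdifferentiableAt (by simp)
  have := mfderiv_comp a h1 h2
  rw [← mfderiv_eq_fderiv]
  unfold localRep
  rw [this]
  rfl

theorem continuousAt_localRep_lift {p : S} {a : Euc m} (ha : a ∈ (extChartAt (𝓡 m) p).target) :
    ContinuousAt (extChartAt (𝓡 m) p).symm a :=
  continuousAt_extChartAt_symm'' ha

end LocalRepresentation

/-! ### Derivative tests at a maximum -/

section Calculus

open Set Filter Topology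

/-- A positive second derivative would make `t` a local minimum as well, so `f` would be locally
constant with vanishing second derivative. -/
theorem deriv_deriv_nonpos_of_isLocalMax {f : ℝ → ℝ} {t : ℝ} (h : IsLocalMax f t)
    (hc : ContinuousAt f t) : deriv (deriv f) t ≤ 0 := by
  by_contra! hpos
  have hmin := isLocalMin_of_deriv_deriv_pos hpos h.deriv_eq_zero hc
  have heq : f =ᶠ[𝓝 t] fun _ ↦ f t := by
    filter_upwards [h, hmin] with s h1 h2 using le_antisymm h1 h2
  have := heq.deriv.deriv_eq
  simp at this
  linarith

/-- The first and second derivative tests for `G ∘ X` along a line, `g` being the gradient of `G`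
and `B` its Hessian at `X a`. -/
theorem isLocalMax_comp_line {E F : Type*} [NormedAddCommGroup E] [NormedSpace ℝ E]
    [NormedAddCommGroup F] [InnerProductSpace ℝ F] [CompleteSpace F]
    {X : E → F} {a : E} (hX : ContDiffAt ℝ 2 X a) {G : F → ℝ} {g : F → F} {B : F →L[ℝ] F}
    (hG : ∀ u, HasFDerivAt G (innerSL ℝ (g u)) u) (hg : HasFDerivAt g B (X a))
    (hmax : IsLocalMax (G ∘ X) a) (v : E) :
    inner ℝ (g (X a)) (fderiv ℝ X a v) = 0 ∧
    inner ℝ (B (fderiv ℝ X a v)) (fderiv ℝ X a v)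
      + inner ℝ (g (X a)) (fderiv ℝ (fderiv ℝ X) a v v) ≤ 0 := by
  have hl0 : (fun t : ℝ ↦ a + t • v) 0 = a := by simp
  have hlc : Continuous fun t : ℝ ↦ a + t • v := by fun_prop
  have hl : Tendsto (fun t : ℝ ↦ a + t • v) (𝓝 0) (𝓝 a) := by
    simpa using hlc.tendsto 0
  have hl' : ∀ t : ℝ, HasDerivAt (fun t : ℝ ↦ a + t • v) v t := fun t ↦ by
    simpa using ((hasDerivAt_id t).smul_const v).const_add a
  set j : ℝ → ℝ := fun t ↦ G (X (a + t • v)) with hj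
  have hjmax : IsLocalMax j 0 := by
    have h1 : ∀ᶠ b in 𝓝 a, G (X b) ≤ G (X a) := hmax
    have h2 := hl.eventually h1
    simpa [IsLocalMax, IsMaxFilter, j] using h2
  have hXd : ∀ᶠ b in 𝓝 a, DifferentiableAt ℝ X b := by
    filter_upwards [hX.eventually (by simp)] with b hb using hb.differentiableAt (by simp)
  have hXd0 := hXd.self_of_nhds
  have hjd : ∀ᶠ t in 𝓝 (0 : ℝ), HasDerivAt j
      (inner ℝ (g (X (a + t • v))) (fderiv ℝ X (a + t • v) v)) t := by
    filter_upwards [hl.eventually hXd] with t ht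
    have h1 : HasDerivAt (fun t : ℝ ↦ X (a + t • v)) (fderiv ℝ X (a + t • v) v) t :=
      ht.hasFDerivAt.comp_hasDerivAt t (hl' t)
    exact (hG _).comp_hasDerivAt t h1
  have hd1 := hjd.self_of_nhds
  have hcont : ContinuousAt j 0 := hd1.continuousAt
  have hder : deriv j =ᶠ[𝓝 0] fun t ↦ inner ℝ (g (X (a + t • v))) (fderiv ℝ X (a + t • v) v) := by
    filter_upwards [hjd] with t ht using ht.deriv
  have hX2 : DifferentiableAt ℝ (fderiv ℝ X) a :=
    (hX.fderiv_right (m := 1) (by norm_num)).differentiableAt (by simp)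
  have hd2 : HasDerivAt (fun t : ℝ ↦ inner ℝ (g (X (a + t • v))) (fderiv ℝ X (a + t • v) v))
      (inner ℝ (g (X a)) (fderiv ℝ (fderiv ℝ X) a v v)
        + inner ℝ (B (fderiv ℝ X a v)) (fderiv ℝ X a v)) 0 := by
    have e1 : HasDerivAt (fun t : ℝ ↦ fderiv ℝ X (a + t • v) v)
        (fderiv ℝ (fderiv ℝ X) a v v) 0 := by
      have h1 : HasDerivAt (fun t : ℝ ↦ fderiv ℝ X (a + t • v)) (fderiv ℝ (fderiv ℝ X) a v) 0 := by
        have := hX2.hasFDerivAt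
        rw [← hl0] at this
        have := this.comp_hasDerivAt 0 (hl' 0)
        simpa using! this
      simpa using h1.clm_apply (hasDerivAt_const 0 v)
    have e2 : HasDerivAt (fun t : ℝ ↦ g (X (a + t • v))) (B (fderiv ℝ X a v)) 0 := by
      have h0 : HasFDerivAt X (fderiv ℝ X a) (a + (0:ℝ) • v) := by simpa using hXd0.hasFDerivAt
      have h1 : HasDerivAt (fun t : ℝ ↦ X (a + t • v)) (fderiv ℝ X a v) 0 :=
        h0.comp_hasDerivAt 0 (hl' 0)
      have h2 : HasFDerivAt g B (X (a + (0:ℝ) • v)) := by simpa using hg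
      exact h2.comp_hasDerivAt 0 h1
    simpa using e2.inner ℝ e1
  constructor
  · have h0 := hjmax.hasDerivAt_eq_zero hd1
    simpa using h0
  · have h0 := deriv_deriv_nonpos_of_isLocalMax hjmax hcont
    rw [hder.deriv_eq, hd2.deriv] at h0
    linarith

end Calculus

/-! ### The drift Laplacian at a local maximum -/

section Pointwise

open Set Filter Topology

variable {m : ℕ} {S : Type*} [TopologicalSpace S] [ChartedSpace (Euc m) S]
  [IsManifold (𝓡 m) ∞ S]

instance (p : S) : FiniteDimensional ℝ (TangentSpace (𝓡 m) p) :=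
  inferInstanceAs (FiniteDimensional ℝ (Euc m))

omit [IsManifold (𝓡 m) ∞ S] in
theorem finrank_tangentSpace_eq (p : S) : Module.finrank ℝ (TangentSpace (𝓡 m) p) = m := by
  have : Module.finrank ℝ (Euc m) = m := by simp
  exact this

variable [Bundle.RiemannianBundle (fun p : S ↦ TangentSpace (𝓡 m) p)]

/-- The image under `dx_p` of the standard orthonormal basis of `T_p S`. -/
noncomputable def tangentFrame (x : S → Euc (m + 1)) (p : S)
    (i : Fin (Module.finrank ℝ (TangentSpace (𝓡 m) p))) : Euc (m + 1) :=
  differential x p (stdOrthonormalBasis ℝ (TangentSpace (𝓡 m) p) i)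


omit [IsManifold (𝓡 m) ∞ S] in
theorem IsIsometricImmersion.orthonormal_tangentFrame {x : S → Euc (m + 1)}
    (hx : IsIsometricImmersion x) (p : S) : Orthonormal ℝ (tangentFrame x p) := by
  have h := (stdOrthonormalBasis ℝ (TangentSpace (𝓡 m) p)).orthonormal
  rw [orthonormal_iff_ite] at h ⊢
  intro i j
  rw [tangentFrame, tangentFrame, hx.isometric]
  exact h i j

omit [IsManifold (𝓡 m) ∞ S] [Bundle.RiemannianBundle (fun p : S ↦ TangentSpace (𝓡 m) p)] in
-- The projection is self-adjoint and fixes normal vectors. Paired with a normal gradient, `x^⊥` may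
-- thus be replaced by `x`, and the second fundamental form by the plain second derivative in a
-- chart.
theorem inner_normalPart_of_mem {x : S → Euc (m + 1)} {p : S} {g : Euc (m + 1)}
    (hg : ∀ v, inner ℝ g (differential x p v) = 0) (w : Euc (m + 1)) :
    inner ℝ g (normalPart x p w) = inner ℝ g w := by
  have hmem : g ∈ normalSpace x p := by
    rw [normalSpace, Submodule.mem_orthogonal']
    rintro _ ⟨v, rfl⟩
    exact hg v
  rw [normalPart, ← Submodule.inner_starProjection_left_eq_right,
    Submodule.starProjection_eq_self_iff.2 hmem]

/-- If `G` restricted to a self-shrinker has a local maximum at `p`, then the drift Laplacian of `G`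
is nonpositive at `p`. -/
theorem IsSelfShrinker.sum_hessian_le_of_isLocalMax {x : S → Euc (m + 1)}
    (hx : IsSelfShrinker x) {p : S} {G : Euc (m + 1) → ℝ} {g : Euc (m + 1) → Euc (m + 1)}
    {B : Euc (m + 1) →L[ℝ] Euc (m + 1)}
    (hG : ∀ u, HasFDerivAt G (innerSL ℝ (g u)) u) (hg : HasFDerivAt g B (x p))
    (hmax : IsLocalMax (G ∘ x) p) :
    (∀ v, inner ℝ (g (x p)) (differential x p v) = 0) ∧
    ∑ i, inner ℝ (B (tangentFrame x p i)) (tangentFrame x p i) ≤ inner ℝ (g (x p)) (x p) := by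
  set a := extChartAt (𝓡 m) p p with ha
  have hX : ContDiffAt ℝ 2 (localRep x p) a :=
    (contDiffAt_localRep hx.immersion.smooth p (mem_extChartAt_target p)).of_le
      ENat.LEInfty.out
  have hmax' : IsLocalMax (G ∘ localRep x p) a := by
    have h1 : Tendsto (extChartAt (𝓡 m) p).symm (𝓝 a) (𝓝 p) := by
      have := continuousAt_localRep_lift (mem_extChartAt_target (I := 𝓡 m) p)
      rwa [ContinuousAt, extChartAt_to_inv] at this
    have h2 := h1.eventually hmax
    filter_upwards [h2] with b hb
    simpa [localRep, ha] using hb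
  have hg' : HasFDerivAt g B (localRep x p a) := by rwa [localRep_base]
  have key := isLocalMax_comp_line hX hG hg' hmax'
  simp only [ha, localRep_base, ← differential_eq_fderiv_localRep hx.immersion.smooth] at key
  have hperp : ∀ v, inner ℝ (g (x p)) (differential x p v) = 0 := fun v ↦ (key v).1
  refine ⟨hperp, ?_⟩
  -- The gradient is normal at a critical point, so the trace is `⟨g, H⟩ = -⟨g, x^⊥⟩ = -⟨g, x⟩`.
  have hH : ∑ i, inner ℝ (g (x p)) (secondFundamentalForm x p
      (stdOrthonormalBasis ℝ (TangentSpace (𝓡 m) p) i)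
      (stdOrthonormalBasis ℝ (TangentSpace (𝓡 m) p) i)) = - inner ℝ (g (x p)) (x p) := by
    rw [← inner_sum, ← inner_normalPart_of_mem hperp (x p), hx.equation p, inner_neg_right, neg_neg]
    rfl
  have hsum : ∑ i, (inner ℝ (B (tangentFrame x p i)) (tangentFrame x p i)
      + inner ℝ (g (x p)) (secondFundamentalForm x p
      (stdOrthonormalBasis ℝ (TangentSpace (𝓡 m) p) i)
      (stdOrthonormalBasis ℝ (TangentSpace (𝓡 m) p) i))) ≤ 0 := by
    refine Finset.sum_nonpos fun i _ ↦ ?_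
    rw [secondFundamentalForm, inner_normalPart_of_mem hperp]
    exact (key _).2
  rw [Finset.sum_add_distrib, hH] at hsum
  linarith

end Pointwise

end SelfShrinker

namespace SelfShrinker

/-! ### A ball touching the contact set -/

section InteriorTouching

open Set Filter Topology Metric

/-- The closed ball with diameter from `u'` to `w` lies in the closed ball of radius `‖u' - w‖`
about `w` and meets its boundary sphere only at `u'`. Halving a touching ball in this way makes the
contact strict. -/
theorem eq_of_norm_sub_midpoint_le {V : Type*} [NormedAddCommGroup V] [InnerProductSpace ℝ V]
    {u u' w : V} (h1 : ‖u' - w‖ ≤ ‖u - w‖) (h2 : ‖u - midpoint ℝ u' w‖ ≤ ‖u' - w‖ / 2) :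
    u = u' := by
  set e := u - midpoint ℝ u' w with he
  set f := (1 / 2 : ℝ) • (u' - w) with hf
  have hm : midpoint ℝ u' w = (1 / 2 : ℝ) • (u' + w) := by
    rw [midpoint_eq_smul_add]; norm_num
  have h3 : u - w = e + f := by rw [he, hf, hm]; module
  have h4 : u - u' = e - f := by rw [he, hf, hm]; module
  have h5 : ‖f‖ = ‖u' - w‖ / 2 := by rw [hf, norm_smul]; norm_num; ring
  have h6 : ‖u' - w‖ = 2 * ‖f‖ := by linarith
  rw [h3, h6] at h1
  rw [← h5] at h2
  have hp := parallelogram_law_with_norm ℝ e f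
  have h7 : (2 * ‖f‖) * (2 * ‖f‖) ≤ ‖e + f‖ * ‖e + f‖ := by gcongr
  have h8 : ‖e‖ * ‖e‖ ≤ ‖f‖ * ‖f‖ := by gcongr
  have h9 : ‖e - f‖ * ‖e - f‖ ≤ 0 := by nlinarith
  have h10 : ‖e - f‖ = 0 := by nlinarith [norm_nonneg (e - f)]
  rw [← sub_eq_zero, h4]
  exact norm_eq_zero.1 h10

/-- An immersion is uniformly close to its derivative: near `a₀`, chords are comparable to chart
vectors and make an acute angle with the image of the chart vector. -/
theorem exists_closedBall_chord_estimates {E V : Type*} [NormedAddCommGroup E] [NormedSpace ℝ E]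
    [NormedAddCommGroup V] [InnerProductSpace ℝ V] {X : E → V} {a₀ : E}
    (hX : ContDiffAt ℝ 1 X a₀) {c : ℝ} (hc : 0 < c) (hinj : ∀ v, c * ‖v‖ ≤ ‖fderiv ℝ X a₀ v‖)
    {U : Set E} (hU : U ∈ 𝓝 a₀) :
    ∃ ρ > 0, closedBall a₀ ρ ⊆ U ∧ ∀ a ∈ closedBall a₀ ρ, ∀ b ∈ closedBall a₀ ρ,
      c / 2 * ‖a - b‖ ≤ ‖X a - X b‖ ∧
      ∀ a' ∈ closedBall a₀ ρ, ‖X a - X b - fderiv ℝ X a' (a - b)‖ ≤ c / 4 * ‖a - b‖ := by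
  have hs : HasStrictFDerivAt X (fderiv ℝ X a₀) a₀ := hX.hasStrictFDerivAt (by simp)
  -- One error `c / 8` comes from linearising at `a₀`, another from moving the derivative to `a'`;
  -- together they give `c / 4`.
  have h1 := hs.isLittleO.def (c := c / 8) (by positivity)
  rw [nhds_prod_eq] at h1
  obtain ⟨W, hW, hWX⟩ := mem_prod_self_iff.1 h1
  have hcont : ContinuousAt (fderiv ℝ X) a₀ :=
    (hX.fderiv_right (m := 0) (by norm_num)).continuousAt
  have h2 : {a | ‖fderiv ℝ X a - fderiv ℝ X a₀‖ < c / 8} ∈ 𝓝 a₀ := by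
    have := hcont (ball_mem_nhds _ (show 0 < c / 8 by positivity))
    simpa [ball, dist_eq_norm] using this
  obtain ⟨ρ, hρ, hsub⟩ := nhds_basis_closedBall.mem_iff.1 (inter_mem hU (inter_mem hW h2))
  refine ⟨ρ, hρ, fun a ha ↦ (hsub ha).1, fun a ha b hb ↦ ?_⟩
  have h3 : ‖X a - X b - fderiv ℝ X a₀ (a - b)‖ ≤ c / 8 * ‖a - b‖ :=
    hWX (mk_mem_prod (hsub ha).2.1 (hsub hb).2.1)
  constructor
  · have h4 := norm_sub_norm_le (fderiv ℝ X a₀ (a - b)) (X a - X b)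
    rw [norm_sub_rev _ (X a - X b)] at h4
    nlinarith [hinj (a - b), norm_nonneg (a - b)]
  · intro a' ha'
    have h5 : ‖(fderiv ℝ X a' - fderiv ℝ X a₀) (a - b)‖ ≤ c / 8 * ‖a - b‖ :=
      ContinuousLinearMap.le_of_opNorm_le _ (hsub ha').2.2.le _
    have h6 : X a - X b - fderiv ℝ X a' (a - b) =
      (X a - X b - fderiv ℝ X a₀ (a - b)) - (fderiv ℝ X a' - fderiv ℝ X a₀) (a - b) := by
      simp
    rw [h6]
    refine (norm_sub_le _ _).trans ?_
    linarith

/-- If `φ ≤ M` is not locally constant equal to `M` at the point `a₀` where it equals `M`, then the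
image under the immersion `X` of its contact set is touched from outside by a ball of the ambient
space whose radius at the touching point is not normal to `X`. -/
theorem exists_touching_ball {E V : Type*} [NormedAddCommGroup E] [NormedSpace ℝ E]
    [FiniteDimensional ℝ E] [NormedAddCommGroup V] [InnerProductSpace ℝ V] {X : E → V} {a₀ : E}
    {U : Set E} (hU : IsOpen U) (ha₀ : a₀ ∈ U) (hX : ContDiffOn ℝ 1 X U) {c : ℝ} (hc : 0 < c)
    (hinj : ∀ v, c * ‖v‖ ≤ ‖fderiv ℝ X a₀ v‖) {φ : E → ℝ} {M : ℝ} (hφ : ContinuousOn φ U)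
    (hφ₀ : φ a₀ = M) (hfreq : ∃ᶠ b in 𝓝 a₀, φ b ≠ M) :
    ∃ a' η : _, ∃ z : V, ∃ v : E, 0 < η ∧ closedBall a' η ⊆ U ∧ φ a' = M ∧
      (∀ a ∈ sphere a' η, φ a = M → ‖X a' - z‖ < ‖X a - z‖) ∧
      ∀ a ∈ closedBall a' η, 0 < inner ℝ (X a - z) (fderiv ℝ X a v) := by
  have : ProperSpace E := FiniteDimensional.proper ℝ E
  have hUn := hU.mem_nhds ha₀
  obtain ⟨ρ, hρ, hρU, hest⟩ := exists_closedBall_chord_estimates (hX.contDiffAt hUn) hc hinj hUn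
  have hXc : ContinuousOn X U := hX.continuousOn
  have hcont : ContinuousAt X a₀ := hXc.continuousAt hUn
  have hK : IsCompact (closedBall a₀ ρ ∩ φ ⁻¹' {M}) :=
    (isCompact_closedBall a₀ ρ).of_isClosed_subset
      ((hφ.mono hρU).preimage_isClosed_of_isClosed isClosed_closedBall isClosed_singleton)
      inter_subset_left
  have hnear : ∀ᶠ b in 𝓝 a₀, ‖X a₀ - X b‖ < c / 2 * (ρ / 2) := by
    have h1 : Tendsto (fun b ↦ ‖X a₀ - X b‖) (𝓝 a₀) (𝓝 0) := by
      have : ContinuousAt (fun b ↦ ‖X a₀ - X b‖) a₀ := by fun_prop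
      simpa [ContinuousAt] using this
    exact h1.eventually_lt_const (by positivity)
  obtain ⟨b, hbM, hbX, hbρ⟩ :=
    (hfreq.and_eventually (hnear.and (ball_mem_nhds a₀ (half_pos hρ)))).exists
  have ha₀K : a₀ ∈ closedBall a₀ ρ ∩ φ ⁻¹' {M} := ⟨mem_closedBall_self hρ.le, hφ₀⟩
  have hbc : b ∈ closedBall a₀ ρ := by
    rw [mem_closedBall]; exact hbρ.le.trans (by linarith)
  -- `a'` is a contact point whose image is nearest to `X b`, where `b` is a non-contact point.
  -- Since `b` was chosen close to `a₀`, both in the chart and in the image, `a'` stays off the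
  -- boundary of the large ball.
  obtain ⟨a', ha'K, hmin⟩ := hK.exists_isMinOn ⟨a₀, ha₀K⟩
    (f := fun a ↦ ‖X a - X b‖) (((hXc.mono hρU).mono inter_subset_left).sub
      continuousOn_const).norm
  have hab : a' ≠ b := by rintro rfl; exact hbM ha'K.2
  have hd := (hest a' ha'K.1 b hbc).1
  have hda : ‖a' - b‖ < ρ / 2 := by
    have h1 : ‖X a' - X b‖ ≤ ‖X a₀ - X b‖ := hmin ha₀K
    have : c / 2 * ‖a' - b‖ < c / 2 * (ρ / 2) := by linarith
    exact lt_of_mul_lt_mul_left this (by positivity)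
  have ha'ball : a' ∈ ball a₀ ρ := by
    rw [mem_ball]
    have := dist_triangle a' b a₀
    rw [dist_eq_norm a' b] at this
    linarith
  have hpos : 0 < ‖a' - b‖ := norm_pos_iff.2 (sub_ne_zero.2 hab)
  set z := midpoint ℝ (X a') (X b) with hz
  have hXz : X a' - z = (1 / 2 : ℝ) • (X a' - X b) := by
    rw [hz, midpoint_eq_smul_add]; norm_num; module
  have hr : ‖X a' - z‖ = ‖X a' - X b‖ / 2 := by rw [hXz, norm_smul]; norm_num; ring
  -- The chord has length at least `c / 2 * ‖a' - b‖` and differs from the derivative by at most `c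
  -- / 4 * ‖a' - b‖`, so the two form an acute angle.
  have hθ : 0 < inner ℝ (X a' - z) (fderiv ℝ X a' (a' - b)) := by
    rw [hXz, inner_smul_left]
    have h1 := (hest a' ha'K.1 b hbc).2 a' ha'K.1
    set d := X a' - X b with hdd
    have h2 : inner ℝ d (fderiv ℝ X a' (a' - b))
        = ‖d‖ ^ 2 - inner ℝ d (d - fderiv ℝ X a' (a' - b)) := by
      rw [inner_sub_right, real_inner_self_eq_norm_sq]; ring
    have h3 := (real_inner_le_norm d (d - fderiv ℝ X a' (a' - b)))
    have h4 : 0 < ‖d‖ := by nlinarith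
    have h5 : ‖d‖ * ‖d - fderiv ℝ X a' (a' - b)‖ ≤ ‖d‖ * (c / 4 * ‖a' - b‖) := by gcongr
    have h6 : ‖d‖ * (c / 4 * ‖a' - b‖) < ‖d‖ * ‖d‖ := by
      apply mul_lt_mul_of_pos_left _ h4
      nlinarith
    have h7 : 0 < inner ℝ d (fderiv ℝ X a' (a' - b)) := by rw [h2]; nlinarith
    simpa using h7
  have ha'U : U ∈ 𝓝 a' := hU.mem_nhds (hρU ha'K.1)
  have hθc : ContinuousAt (fun a ↦ inner ℝ (X a - z) (fderiv ℝ X a (a' - b))) a' := by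
    have h1 : ContinuousAt X a' := hXc.continuousAt ha'U
    have h2 : ContinuousAt (fderiv ℝ X) a' :=
      ((hX.contDiffAt ha'U).fderiv_right (m := 0) (by norm_num)).continuousAt
    exact (h1.sub continuousAt_const).inner (h2.clm_apply continuousAt_const)
  obtain ⟨η, hη, hsub⟩ := nhds_basis_closedBall.mem_iff.1
    (inter_mem (isOpen_ball.mem_nhds ha'ball) (hθc.eventually (lt_mem_nhds hθ)))
  refine ⟨a', η, z, a' - b, hη, fun a ha ↦ hρU (ball_subset_closedBall (hsub ha).1), ha'K.2,
    fun a ha haM ↦ ?_, fun a ha ↦ (hsub ha).2⟩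
  by_contra! hle
  have haρ : a ∈ closedBall a₀ ρ := ball_subset_closedBall (hsub (sphere_subset_closedBall ha)).1
  have h1 : ‖X a' - X b‖ ≤ ‖X a - X b‖ := hmin ⟨haρ, haM⟩
  have h2 : X a = X a' := eq_of_norm_sub_midpoint_le h1 (hr ▸ hle)
  have h3 := (hest a haρ a' ha'K.1).1
  rw [h2, sub_self, norm_zero] at h3
  have h4 : ‖a - a'‖ = η := by rw [← dist_eq_norm]; exact ha
  rw [h4] at h3
  have : 0 < c / 2 * η := by positivity
  linarith

end InteriorTouching

end SelfShrinker

namespace SelfShrinker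

/-! ### The Gaussian barrier -/

section Barrier

open Set Filter Topology Metric

/-- Where `h < 0` any positive `ε` works. On the compact set where `h ≥ 0`, `φ` has a maximum
strictly below `M`, and `ε` is this gap divided by a bound for `h`. -/
theorem exists_pos_add_mul_lt {E : Type*} [TopologicalSpace E] {Q : Set E} (hQ : IsCompact Q)
    {φ h : E → ℝ} {M : ℝ} (hφ : ContinuousOn φ Q) (hh : ContinuousOn h Q)
    (hle : ∀ a ∈ Q, φ a ≤ M) (hneg : ∀ a ∈ Q, φ a = M → h a < 0) :
    ∃ ε > 0, ∀ a ∈ Q, φ a + ε * h a < M := by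
  obtain ⟨H, hH⟩ := hQ.bddAbove_image hh
  have hQ' : IsCompact {a ∈ Q | 0 ≤ h a} := by
    obtain ⟨C, hC, hCQ⟩ := continuousOn_iff_isClosed.1 hh (Ici 0) isClosed_Ici
    have : {a ∈ Q | 0 ≤ h a} = Q ∩ C := by
      ext a
      have := congr(a ∈ $hCQ)
      simp only [mem_inter_iff, mem_preimage, mem_Ici] at this
      simp only [mem_ofPred_eq, mem_inter_iff]
      grind
    rw [this]
    exact hQ.inter_right hC
  rcases {a ∈ Q | 0 ≤ h a}.eq_empty_or_nonempty with hempty | hne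
  · refine ⟨1, one_pos, fun a ha ↦ ?_⟩
    have h1 : h a < 0 := by
      by_contra! hge
      exact (hempty ▸ (⟨ha, hge⟩ : a ∈ {a ∈ Q | 0 ≤ h a}) : a ∈ (∅ : Set E))
    linarith [hle a ha]
  · obtain ⟨a₁, ha₁, hmax⟩ := hQ'.exists_isMaxOn hne (hφ.mono fun a ha ↦ ha.1)
    have hlt : φ a₁ < M := by
      refine lt_of_le_of_ne (hle _ ha₁.1) fun heq ↦ ?_
      linarith [hneg a₁ ha₁.1 heq, ha₁.2]
    have hε : 0 < (M - φ a₁) / (|H| + 1) := div_pos (by linarith) (by positivity)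
    refine ⟨_, hε, fun a ha ↦ ?_⟩
    rcases lt_or_ge (h a) 0 with hlt' | hge
    · linarith [mul_neg_of_pos_of_neg hε hlt', hle a ha]
    · have h1 : φ a ≤ φ a₁ := hmax ⟨ha, hge⟩
      have h2 : h a < |H| + 1 := by
        have : h a ≤ H := hH (mem_image_of_mem _ ha)
        linarith [le_abs_self H]
      have h3 : (M - φ a₁) / (|H| + 1) * h a < (M - φ a₁) / (|H| + 1) * (|H| + 1) :=
        mul_lt_mul_of_pos_left h2 hε
      rw [div_mul_cancel₀ _ (by positivity)] at h3
      linarith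

variable {V : Type*} [NormedAddCommGroup V] [InnerProductSpace ℝ V]

theorem hasFDerivAt_exp_neg_mul_norm_sub_sq (α : ℝ) (z u : V) :
    HasFDerivAt (fun u ↦ Real.exp (-α * ‖u - z‖ ^ 2))
      (innerSL ℝ ((-2 * α * Real.exp (-α * ‖u - z‖ ^ 2)) • (u - z))) u := by
  have h := ((((hasFDerivAt_id u).sub_const z).norm_sq).const_mul (-α)).exp
  refine h.congr_fderiv ?_
  ext w
  simp
  ring

/-- The Hessian at `u` of `u ↦ exp (-α |u - z|²)`. -/
noncomputable def gaussianHessian (α : ℝ) (z u : V) : V →L[ℝ] V :=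
  (-2 * α * Real.exp (-α * ‖u - z‖ ^ 2)) • ContinuousLinearMap.id ℝ V +
    (4 * α ^ 2 * Real.exp (-α * ‖u - z‖ ^ 2)) • (innerSL ℝ (u - z)).smulRight (u - z)

theorem hasFDerivAt_gaussian_gradient (α : ℝ) (z u : V) :
    HasFDerivAt (fun u ↦ (-2 * α * Real.exp (-α * ‖u - z‖ ^ 2)) • (u - z))
      (gaussianHessian α z u) u := by
  have h := ((hasFDerivAt_exp_neg_mul_norm_sub_sq α z u).const_mul (-2 * α)).smul
    ((hasFDerivAt_id u).sub_const z)
  refine h.congr_fderiv ?_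
  ext w
  simp [gaussianHessian, smul_smul]
  ring_nf

/-- For large `α` the quadratic term in `α` dominates in every direction not orthogonal to `u - z`;
this makes the Gaussian a barrier. -/
theorem inner_gaussianHessian (α : ℝ) (z u w : V) :
    inner ℝ (gaussianHessian α z u w) w = Real.exp (-α * ‖u - z‖ ^ 2) *
      (4 * α ^ 2 * inner ℝ (u - z) w ^ 2 - 2 * α * ‖w‖ ^ 2) := by
  rw [gaussianHessian, add_apply, smul_apply, smul_apply, ContinuousLinearMap.smulRight_apply,
    innerSL_apply_apply, inner_add_left, real_inner_smul_left, real_inner_smul_left,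
    real_inner_smul_left, ContinuousLinearMap.id_apply, real_inner_self_eq_norm_sq]
  ring

end Barrier

/-! ### The strong maximum principle -/

section StrongMaximum

open Set Filter Topology Metric

variable {m : ℕ} {S : Type*} [TopologicalSpace S] [ChartedSpace (Euc m) S]
  [Bundle.RiemannianBundle (fun p : S ↦ TangentSpace (𝓡 m) p)]

/-- Cauchy–Schwarz in the tangent frame. It bounds the tangential part of `y` from below by its
component along a single tangent vector. -/
theorem IsIsometricImmersion.inner_differential_sq_le {x : S → Euc (m + 1)}
    (hx : IsIsometricImmersion x) (p : S) (y : Euc (m + 1)) (w : TangentSpace (𝓡 m) p) :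
    inner ℝ y (differential x p w) ^ 2 ≤
      ‖differential x p w‖ ^ 2 * ∑ i, inner ℝ y (tangentFrame x p i) ^ 2 := by
  set b := stdOrthonormalBasis ℝ (TangentSpace (𝓡 m) p) with hb
  have h1 : differential x p w = ∑ i, inner ℝ (b i) w • tangentFrame x p i := by
    conv_lhs => rw [← b.sum_repr' w]
    rw [map_sum]
    simp only [map_smul]
    rfl
  have h2 : ‖differential x p w‖ ^ 2 = ∑ i, inner ℝ (b i) w ^ 2 := by
    rw [← real_inner_self_eq_norm_sq, hx.isometric, real_inner_self_eq_norm_sq,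
      ← b.sum_sq_norm_inner_right]
    simp
  rw [h2, h1, inner_sum]
  simp only [inner_smul_right]
  exact Finset.sum_mul_sq_le_sq_mul_sq _ _ _

theorem IsIsometricImmersion.norm_differential {x : S → Euc (m + 1)}
    (hx : IsIsometricImmersion x) (p : S) (w : TangentSpace (𝓡 m) p) :
    ‖differential x p w‖ = ‖w‖ := by
  have := hx.isometric p w w
  rw [real_inner_self_eq_norm_sq, real_inner_self_eq_norm_sq] at this
  exact (sq_eq_sq₀ (norm_nonneg _) (norm_nonneg _)).1 this

theorem IsIsometricImmersion.differential_injective {x : S → Euc (m + 1)}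
    (hx : IsIsometricImmersion x) (p : S) : Function.Injective (differential x p) := by
  rw [injective_iff_map_eq_zero]
  intro w hw
  rw [← norm_eq_zero, ← hx.norm_differential, hw, norm_zero]

variable [IsManifold (𝓡 m) ∞ S]

theorem IsIsometricImmersion.exists_antilipschitz_fderiv_localRep {x : S → Euc (m + 1)}
    (hx : IsIsometricImmersion x) (p : S) : ∃ c > 0, ∀ v : Euc m,
      c * ‖v‖ ≤ ‖fderiv ℝ (localRep x p) (extChartAt (𝓡 m) p p) v‖ := by
  have hker : LinearMap.ker (fderiv ℝ (localRep x p) (extChartAt (𝓡 m) p p)).toLinearMap = ⊥ := by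
    rw [LinearMap.ker_eq_bot']
    intro v hv
    have h1 : differential x p v = 0 := by
      rw [differential_eq_fderiv_localRep hx.smooth]; exact hv
    exact hx.differential_injective p (h1.trans (map_zero _).symm)
  obtain ⟨K, hK, h⟩ := LinearMap.exists_antilipschitzWith _ hker
  refine ⟨(K : ℝ)⁻¹, by positivity, fun v ↦ ?_⟩
  have := h.le_mul_dist v 0
  rw [map_zero, dist_zero_right, dist_zero_right] at this
  rw [inv_mul_le_iff₀ (by positivity)]
  exact this

/-- Hopf's argument: `hsub` says that `F ∘ x` is a subsolution. If the contact set were not a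
neighbourhood of `p₀`, a touching ball centred at `z` would exist. Adding a small multiple of `exp
(-α |u - z|²)` then produces an interior maximum near the touching point, where for large `α` the
drift Laplacian is strictly positive, which is impossible. -/
theorem IsSelfShrinker.isOpen_eq_max {x : S → Euc (m + 1)} (hx : IsSelfShrinker x)
    {F : Euc (m + 1) → ℝ} {f : Euc (m + 1) → Euc (m + 1)}
    {B : Euc (m + 1) → Euc (m + 1) →L[ℝ] Euc (m + 1)}
    (hF : ∀ u, HasFDerivAt F (innerSL ℝ (f u)) u) (hf : ∀ u, HasFDerivAt f (B u) u)
    (hsub : ∀ p, inner ℝ (f (x p)) (x p) ≤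
      ∑ i, inner ℝ (B (x p) (tangentFrame x p i)) (tangentFrame x p i))
    {M : ℝ} (hM : ∀ p, F (x p) ≤ M) : IsOpen {p | F (x p) = M} := by
  rw [isOpen_iff_mem_nhds]
  intro p₀ hp₀
  by_contra hnot
  set e := extChartAt (𝓡 m) p₀ with he
  set X := localRep x p₀ with hX
  have hFc : Continuous F := continuous_iff_continuousAt.2 fun u ↦ (hF u).continuousAt
  have htarget : IsOpen e.target := isOpen_extChartAt_target p₀
  have hXs : ContDiffOn ℝ 1 X e.target :=
    (contDiffOn_localRep hx.immersion.smooth p₀).of_le ENat.LEInfty.out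
  obtain ⟨c, hc, hinj⟩ := hx.immersion.exists_antilipschitz_fderiv_localRep p₀
  have hfreq : ∃ᶠ b in 𝓝 (e p₀), F (X b) ≠ M := by
    intro hev
    refine hnot ?_
    have h1 : ContinuousAt e p₀ := continuousAt_extChartAt p₀
    filter_upwards [h1.eventually hev, extChartAt_source_mem_nhds (I := 𝓡 m) p₀] with p h2 h3
    rw [not_not, hX, localRep_apply, ← he, e.left_inv h3] at h2
    exact h2
  obtain ⟨a', η, z, v, hη, hsubset, ha'M, hsphere, hpos⟩ :=
    exists_touching_ball htarget (mem_extChartAt_target p₀) hXs hc hinj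
      (hFc.comp_continuousOn hXs.continuousOn) ((congrArg F (localRep_base x p₀)).trans hp₀) hfreq
  have : ProperSpace (Euc m) := inferInstance
  have hXK : ContinuousOn X (closedBall a' η) := hXs.continuousOn.mono hsubset
  have hDK : ContinuousOn (fun a ↦ fderiv ℝ X a v) (closedBall a' η) :=
    ((hXs.continuousOn_fderiv_of_isOpen htarget le_rfl).mono hsubset).clm_apply continuousOn_const
  have hDpos : ∀ a ∈ closedBall a' η, 0 < ‖fderiv ℝ X a v‖ := fun a ha ↦ by
    rw [norm_pos_iff]
    intro h0
    have := hpos a ha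
    rw [h0, inner_zero_right] at this
    exact lt_irrefl _ this
  -- Any `α` above this quotient makes the drift Laplacian of the Gaussian positive on the chart
  -- ball. The denominator is nonzero because the radius from `z` is not normal there.
  obtain ⟨α₀, hα₀⟩ := (isCompact_closedBall a' η).bddAbove_image
    (f := fun a ↦ (m - inner ℝ (X a - z) (X a)) * ‖fderiv ℝ X a v‖ ^ 2 /
      (2 * inner ℝ (X a - z) (fderiv ℝ X a v) ^ 2)) (by
      refine ContinuousOn.div ?_ ?_ fun a ha ↦ ?_
      · exact (continuousOn_const.sub ((hXK.sub continuousOn_const).inner hXK)).mul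
          (hDK.norm.pow 2)
      · exact continuousOn_const.mul (((hXK.sub continuousOn_const).inner hDK).pow 2)
      · have := hpos a ha; positivity)
  set α := max α₀ 0 + 1 with hα
  have hαpos : 0 < α := by positivity
  have hαK : ∀ a ∈ closedBall a' η, (m - inner ℝ (X a - z) (X a)) * ‖fderiv ℝ X a v‖ ^ 2 <
      2 * α * inner ℝ (X a - z) (fderiv ℝ X a v) ^ 2 := fun a ha ↦ by
    have h1 := hα₀ (mem_image_of_mem _ ha)
    have h2 := hpos a ha
    have h3 : α₀ < α := by rw [hα]; linarith [le_max_left α₀ 0]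
    have h4 := h1.trans_lt h3
    rw [div_lt_iff₀ (by positivity)] at h4
    linarith
  set E : Euc (m + 1) → ℝ := fun u ↦ Real.exp (-α * ‖u - z‖ ^ 2) with hE
  have hEc : Continuous E := by rw [hE]; fun_prop
  have hFX : ContinuousOn (fun a ↦ F (X a)) (closedBall a' η) := hFc.comp_continuousOn hXK
  have hEX : ContinuousOn (fun a ↦ E (X a)) (closedBall a' η) := hEc.comp_continuousOn hXK
  -- Contact points on the sphere are farther from `z` than `X a'`, so the Gaussian is smaller there
  -- than at `a'`. The perturbed maximum is therefore not on the sphere.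
  obtain ⟨ε, hε, hεS⟩ := exists_pos_add_mul_lt (isCompact_sphere a' η) (M := M)
    (hFX.mono sphere_subset_closedBall)
    ((hEX.mono sphere_subset_closedBall).sub (continuousOn_const (c := E (X a'))))
    (fun a _ ↦ hM _) (fun a ha haM ↦ by
      have h1 := hsphere a ha haM
      have h2 : ‖X a' - z‖ ^ 2 < ‖X a - z‖ ^ 2 := by gcongr
      have h3 : E (X a) < E (X a') := Real.exp_lt_exp.2 (by nlinarith)
      simpa using h3)
  obtain ⟨a, haK, hmax⟩ := (isCompact_closedBall a' η).exists_isMaxOn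
    ⟨a', mem_closedBall_self hη.le⟩ (f := fun a ↦ F (X a) + ε * E (X a))
    (hFX.add (continuousOn_const.mul (hEc.comp_continuousOn hXK)))
  have hge : M + ε * E (X a') ≤ F (X a) + ε * E (X a) := by
    have h1 := hmax (mem_closedBall_self hη.le)
    simp only [mem_ofPred_eq] at h1
    have h2 : F (X a') = M := ha'M
    rwa [h2] at h1
  have haball : a ∈ ball a' η := by
    rcases eq_or_lt_of_le (mem_closedBall.1 haK) with h | h
    · have := hεS a h; simp only [Pi.sub_apply] at this; linarith
    · exact h
  have hat : a ∈ e.target := hsubset haK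
  set p := e.symm a with hp
  have hxp : X a = x p := rfl
  have hlocal : IsLocalMax ((fun u ↦ F u + ε * E u) ∘ x) p := by
    have h1 : ContinuousAt e p := continuousAt_extChartAt' (e.map_target hat)
    have h2 : e p = a := e.right_inv hat
    have h3 : ball a' η ∈ 𝓝 (e p) := h2 ▸ isOpen_ball.mem_nhds haball
    have h4 : e.source ∈ 𝓝 p :=
      (isOpen_extChartAt_source p₀).mem_nhds (e.map_target hat)
    filter_upwards [h1 h3, h4] with q hq hqs
    have h5 := hmax (ball_subset_closedBall hq)
    simp only [mem_ofPred_eq] at h5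
    have h6 : X (e q) = x q := by rw [hX, localRep_apply, ← he, e.left_inv hqs]
    rw [h6, hxp] at h5
    exact h5
  have hG : ∀ u, HasFDerivAt (fun u ↦ F u + ε * E u)
      (innerSL ℝ (f u + ε • ((-2 * α * Real.exp (-α * ‖u - z‖ ^ 2)) • (u - z)))) u := fun u ↦ by
    have := (hF u).add ((hasFDerivAt_exp_neg_mul_norm_sub_sq α z u).const_mul ε)
    refine this.congr_fderiv ?_
    rw [map_add, map_smul _ ε]
  have hg : HasFDerivAt (fun u ↦ f u + ε • ((-2 * α * Real.exp (-α * ‖u - z‖ ^ 2)) • (u - z)))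
      (B (x p) + ε • gaussianHessian α z (x p)) (x p) :=
    (hf _).add ((hasFDerivAt_gaussian_gradient α z (x p)).const_smul ε)
  have hkey := (hx.sum_hessian_le_of_isLocalMax hG hg hlocal).2
  have hEp : 0 < E (x p) := Real.exp_pos _
  have hnorm : ∀ i, ‖tangentFrame x p i‖ = 1 := (hx.immersion.orthonormal_tangentFrame p).1
  set Θ := ∑ i, inner ℝ (x p - z) (tangentFrame x p i) ^ 2 with hΘ
  have hsum : ∑ i, inner ℝ ((B (x p) + ε • gaussianHessian α z (x p)) (tangentFrame x p i))
      (tangentFrame x p i) = ∑ i, inner ℝ (B (x p) (tangentFrame x p i)) (tangentFrame x p i)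
        + ε * E (x p) * (4 * α ^ 2 * Θ - 2 * α * m) := by
    have h1 : ∀ i, inner ℝ ((B (x p) + ε • gaussianHessian α z (x p)) (tangentFrame x p i))
        (tangentFrame x p i) = inner ℝ (B (x p) (tangentFrame x p i)) (tangentFrame x p i)
          + ε * E (x p) * (4 * α ^ 2 * inner ℝ (x p - z) (tangentFrame x p i) ^ 2
            - 2 * α) := fun i ↦ by
      rw [add_apply, inner_add_left, smul_apply, real_inner_smul_left, inner_gaussianHessian,
        hnorm]
      simp only [hE]
      ring
    rw [Finset.sum_congr rfl fun i _ ↦ h1 i, Finset.sum_add_distrib, ← Finset.mul_sum,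
      Finset.sum_sub_distrib, ← Finset.mul_sum, hΘ]
    rw [Finset.sum_const, Finset.card_univ, Fintype.card_fin, nsmul_eq_mul,
      show (Module.finrank ℝ (TangentSpace (𝓡 m) p) : ℝ) = m from
        congrArg Nat.cast (finrank_tangentSpace_eq p)]
    ring
  have hinner : inner ℝ (f (x p) + ε • ((-2 * α * Real.exp (-α * ‖x p - z‖ ^ 2)) • (x p - z)))
      (x p) = inner ℝ (f (x p)) (x p) - 2 * α * ε * E (x p) * inner ℝ (x p - z) (x p) := by
    rw [inner_add_left, real_inner_smul_left, real_inner_smul_left]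
    simp only [hE]
    ring
  rw [hsum, hinner] at hkey
  have h1 := hsub p
  -- By `hsub` the contribution of `F` has a favourable sign and drops out; only the drift Laplacian
  -- of the Gaussian remains.
  have h2 : ε * E (x p) * (2 * α) * (2 * α * Θ - (m - inner ℝ (x p - z) (x p))) ≤ 0 := by
    linarith
  have h3 : 2 * α * Θ - (m - inner ℝ (x p - z) (x p)) ≤ 0 := by
    by_contra! h
    have : 0 < ε * E (x p) * (2 * α) * (2 * α * Θ - (m - inner ℝ (x p - z) (x p))) := by
      positivity
    linarith
  have h4 := hαK a haK
  have h5 := hDpos a haK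
  have h6 : inner ℝ (X a - z) (fderiv ℝ X a v) ^ 2 ≤ ‖fderiv ℝ X a v‖ ^ 2 * Θ := by
    rw [hX, fderiv_localRep_apply hx.immersion.smooth p₀ hat v]
    exact hx.immersion.inner_differential_sq_le p _ _
  rw [hxp] at h4
  rw [hxp] at h6
  have h7 : (m - inner ℝ (x p - z) (x p)) * ‖fderiv ℝ X a v‖ ^ 2
      < (2 * α * Θ) * ‖fderiv ℝ X a v‖ ^ 2 := by
    refine h4.trans_le ?_
    calc _ ≤ 2 * α * (‖fderiv ℝ X a v‖ ^ 2 * Θ) := by gcongr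
      _ = _ := by ring
  have h8 := lt_of_mul_lt_mul_right h7 (by positivity)
  linarith

/-- The strong maximum principle for the drift Laplacian of a self-shrinker. -/
theorem IsSelfShrinker.eq_of_isMax {x : S → Euc (m + 1)} (hx : IsSelfShrinker x)
    {F : Euc (m + 1) → ℝ} {f : Euc (m + 1) → Euc (m + 1)}
    {B : Euc (m + 1) → Euc (m + 1) →L[ℝ] Euc (m + 1)}
    (hF : ∀ u, HasFDerivAt F (innerSL ℝ (f u)) u) (hf : ∀ u, HasFDerivAt f (B u) u)
    (hsub : ∀ p, inner ℝ (f (x p)) (x p) ≤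
      ∑ i, inner ℝ (B (x p) (tangentFrame x p i)) (tangentFrame x p i))
    {p₀ : S} (hmax : ∀ p, F (x p) ≤ F (x p₀)) (p : S) : F (x p) = F (x p₀) := by
  have := hx.connected
  have hFc : Continuous F := continuous_iff_continuousAt.2 fun u ↦ (hF u).continuousAt
  have hclopen : IsClopen {p | F (x p) = F (x p₀)} :=
    ⟨isClosed_eq (hFc.comp hx.immersion.smooth.continuous) continuous_const,
      hx.isOpen_eq_max hF hf hsub hmax⟩
  have h : p ∈ {p | F (x p) = F (x p₀)} := hclopen.eq_univ ⟨p₀, rfl⟩ ▸ mem_univ p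
  exact h

end StrongMaximum

end SelfShrinker

namespace SelfShrinker

/-! ### The projection onto the first `k + 1` coordinates -/

section AxisProjection

variable {m : ℕ}

/-- The orthogonal projection `(y, z) ↦ (y, 0)` of `ℝ^{k+1} × ℝ^{m-k}`. -/
noncomputable def axisProj (k : ℕ) : Euc (m + 1) →L[ℝ] Euc (m + 1) :=
  LinearMap.toContinuousLinearMap
    { toFun := fun u ↦ WithLp.toLp 2 fun i ↦ if (i : ℕ) ≤ k then u i else 0
      map_add' := fun u v ↦ by ext i; simp only [PiLp.add_apply]; split_ifs <;> simp
      map_smul' := fun c u ↦ by ext i; simp }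

theorem axisProj_apply (k : ℕ) (u : Euc (m + 1)) (i : Fin (m + 1)) :
    axisProj k u i = if (i : ℕ) ≤ k then u i else 0 := rfl

theorem axisProj_axisProj (k : ℕ) (u : Euc (m + 1)) : axisProj k (axisProj k u) = axisProj k u := by
  ext i
  simp only [axisProj_apply]
  split_ifs <;> rfl

theorem inner_axisProj_left (k : ℕ) (u v : Euc (m + 1)) :
    inner ℝ (axisProj k u) v = ∑ i ∈ Finset.univ.filter (fun i : Fin (m + 1) ↦ (i : ℕ) ≤ k),
      u i * v i := by
  rw [PiLp.inner_apply, Finset.sum_filter]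
  refine Finset.sum_congr rfl fun i _ ↦ ?_
  rw [axisProj_apply]
  split_ifs <;> simp [mul_comm]

theorem inner_axisProj_axisProj (k : ℕ) (u v : Euc (m + 1)) :
    inner ℝ (axisProj k u) (axisProj k v) = inner ℝ (axisProj k u) v := by
  rw [inner_axisProj_left, inner_axisProj_left]
  refine Finset.sum_congr rfl fun i hi ↦ ?_
  rw [axisProj_apply, if_pos (Finset.mem_filter.1 hi).2]

theorem axisDist_eq_norm (k : ℕ) (u : Euc (m + 1)) : axisDist k u = ‖axisProj k u‖ := by
  rw [axisDist, ← Real.sqrt_sq (norm_nonneg (axisProj k u)), ← real_inner_self_eq_norm_sq,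
    inner_axisProj_axisProj, inner_axisProj_left]
  simp [sq]

theorem card_filter_lt_of_le {k : ℕ} (hk : k ≤ m) :
    (Finset.univ.filter (fun i : Fin (m + 1) ↦ ¬ (i : ℕ) ≤ k)).card = m - k := by
  have h1 : (Finset.univ.filter (fun i : Fin (m + 1) ↦ ¬ (i : ℕ) ≤ k)) =
      Finset.Ioi (⟨k, by omega⟩ : Fin (m + 1)) := by
    ext i
    simp [Fin.lt_def]
  rw [h1, Fin.card_Ioi]
  simp

/-- The trace of the projection to the first `k + 1` coordinates over a hyperplane is at least
`k`. -/
theorem le_sum_inner_axisProj {k : ℕ} (hk : k ≤ m) {ι : Type*} [Fintype ι]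
    (hι : Fintype.card ι = m) {τ : ι → Euc (m + 1)} (hτ : Orthonormal ℝ τ) :
    (k : ℝ) ≤ ∑ i, inner ℝ (axisProj k (τ i)) (τ i) := by
  -- The full trace is `m`, and each of the `m - k` omitted coordinates contributes at most `1` by
  -- Bessel's inequality.
  have h1 : ∑ i, inner ℝ (axisProj k (τ i)) (τ i) +
      ∑ j ∈ Finset.univ.filter (fun j : Fin (m + 1) ↦ ¬ (j : ℕ) ≤ k), ∑ i, τ i j ^ 2 = m := by
    rw [Finset.sum_comm, ← Finset.sum_add_distrib]
    have : ∀ i, inner ℝ (axisProj k (τ i)) (τ i) +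
        ∑ j ∈ Finset.univ.filter (fun j : Fin (m + 1) ↦ ¬ (j : ℕ) ≤ k), τ i j ^ 2 = 1 := fun i ↦ by
      rw [inner_axisProj_left]
      simp only [← sq]
      rw [Finset.sum_filter_add_sum_filter_not, ← EuclideanSpace.real_norm_sq_eq, hτ.1 i, one_pow]
    rw [Finset.sum_congr rfl fun i _ ↦ this i]
    simp [hι]
  have h2 : ∀ j : Fin (m + 1), ∑ i, τ i j ^ 2 ≤ 1 := fun j ↦ by
    have := hτ.sum_inner_products_le (EuclideanSpace.single j (1 : ℝ)) (s := Finset.univ)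
    simpa [EuclideanSpace.inner_single_right] using this
  have h3 : ∑ j ∈ Finset.univ.filter (fun j : Fin (m + 1) ↦ ¬ (j : ℕ) ≤ k), ∑ i, τ i j ^ 2
      ≤ m - k := by
    refine (Finset.sum_le_sum fun j _ ↦ h2 j).trans ?_
    rw [Finset.sum_const, card_filter_lt_of_le hk, nsmul_eq_mul, mul_one, Nat.cast_sub hk]
  linarith

theorem hasFDerivAt_norm_axisProj_sq (k : ℕ) (u : Euc (m + 1)) :
    HasFDerivAt (fun u : Euc (m + 1) ↦ ‖axisProj k u‖ ^ 2)
      (innerSL ℝ ((2 : ℝ) • axisProj k u)) u := by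
  refine ((axisProj k).hasFDerivAt (x := u)).norm_sq.congr_fderiv ?_
  ext w
  simp [inner_axisProj_axisProj]

theorem axisDist_zero (u : Euc (m + 1)) : axisDist 0 u = |u 0| := by
  have h : Finset.univ.filter (fun i : Fin (m + 1) ↦ (i : ℕ) ≤ 0) = {0} := by
    ext i
    simp
  rw [axisDist, h, Finset.sum_singleton, Real.sqrt_sq_eq_abs]

end AxisProjection

/-! ### Confinement to the cylinder -/

section Confinement

open Set

variable {m k : ℕ} {S : Type*} [TopologicalSpace S] [ChartedSpace (Euc m) S]
  [IsManifold (𝓡 m) ∞ S] [Bundle.RiemannianBundle (fun p : S ↦ TangentSpace (𝓡 m) p)]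

omit [IsManifold (𝓡 m) ∞ S] in
theorem IsSelfShrinker.le_sum_hessian {x : S → Euc (m + 1)} (hx : IsSelfShrinker x) (hk : k ≤ m)
    (p : S) : 2 * (k : ℝ) ≤ ∑ i, inner ℝ (((2 : ℝ) • axisProj k (m := m)) (tangentFrame x p i))
      (tangentFrame x p i) := by
  have h := le_sum_inner_axisProj hk (by rw [Fintype.card_fin]; exact finrank_tangentSpace_eq p)
    (hx.immersion.orthonormal_tangentFrame p)
  simp only [smul_apply, real_inner_smul_left, ← Finset.mul_sum]
  linarith

/-- At the maximum of `|y|²` the drift Laplacian gives `k ≤ R²`. There `y` is normal, so the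
shrinker equation gives `R² = -⟨y, H⟩ ≤ R√k`. -/
theorem IsSelfShrinker.eq_sqrt_of_touch {x : S → Euc (m + 1)} (hx : IsSelfShrinker x)
    (hk : k ≤ m) (hH : ∀ p, ‖meanCurvature x p‖ ≤ √(k : ℝ)) {R : ℝ}
    (hconf : ∀ p, axisDist k (x p) ≤ R) {p₀ : S} (hp₀ : axisDist k (x p₀) = R) :
    R = √(k : ℝ) := by
  have hR : 0 ≤ R := hp₀ ▸ Real.sqrt_nonneg _
  have hmax : IsLocalMax ((fun u : Euc (m + 1) ↦ ‖axisProj k u‖ ^ 2) ∘ x) p₀ := by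
    refine Filter.Eventually.of_forall fun p ↦ ?_
    have := hconf p
    rw [← hp₀, axisDist_eq_norm, axisDist_eq_norm] at this
    simp only [Function.comp_apply]
    gcongr
  obtain ⟨hperp, hle⟩ := hx.sum_hessian_le_of_isLocalMax
    (g := fun u ↦ (2 : ℝ) • axisProj k u) (B := (2 : ℝ) • axisProj k)
    (hasFDerivAt_norm_axisProj_sq k) ((axisProj k).hasFDerivAt.const_smul (2 : ℝ)) hmax
  have hnorm : ‖axisProj k (x p₀)‖ = R := by rw [← axisDist_eq_norm, hp₀]
  have hinner : inner ℝ (axisProj k (x p₀)) (x p₀) = R ^ 2 := by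
    rw [← inner_axisProj_axisProj, real_inner_self_eq_norm_sq, hnorm]
  have h1 := (hx.le_sum_hessian hk p₀).trans hle
  rw [real_inner_smul_left, hinner] at h1
  have h2 : R ^ 2 ≤ R * √k := by
    have hperp' : ∀ v, inner ℝ (axisProj k (x p₀)) (differential x p₀ v) = 0 := fun v ↦ by
      have := hperp v
      rw [real_inner_smul_left] at this
      linarith
    have h3 := inner_normalPart_of_mem hperp' (x p₀)
    rw [hx.equation, hinner] at h3
    rw [← h3]
    refine (real_inner_le_norm _ _).trans ?_
    rw [norm_neg, hnorm]
    exact mul_le_mul_of_nonneg_left (hH p₀) hR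
  have h4 : (√(k : ℝ)) ^ 2 = k := Real.sq_sqrt (Nat.cast_nonneg k)
  have h5 : 0 ≤ √(k : ℝ) := Real.sqrt_nonneg _
  have h6 : √(k : ℝ) ≤ R := abs_le_of_sq_le_sq' (by linarith) hR |>.2
  -- If `R = 0`, one cannot divide by `R`, but `√k ≤ R` already forces `√k = 0`.
  rcases hR.eq_or_lt with h0 | hpos
  · linarith
  · exact le_antisymm (by nlinarith) h6

/-- Inside the solid cylinder of radius `√k`, the lower bound `2k - 2|y|²` for the drift Laplacian
of `|y|²` is nonnegative. -/
theorem IsSelfShrinker.axisDist_eq {x : S → Euc (m + 1)} (hx : IsSelfShrinker x) (hk : k ≤ m)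
    (hconf : ∀ p, axisDist k (x p) ≤ √k) {p₀ : S} (hp₀ : axisDist k (x p₀) = √k) (p : S) :
    axisDist k (x p) = √k := by
  have hsq : ∀ p, ‖axisProj k (x p)‖ ^ 2 ≤ k := fun p ↦ by
    rw [← Real.sq_sqrt (Nat.cast_nonneg k), ← axisDist_eq_norm]
    exact pow_le_pow_left₀ (Real.sqrt_nonneg _) (hconf p) 2
  have h := hx.eq_of_isMax (F := fun u ↦ ‖axisProj k u‖ ^ 2) (p₀ := p₀)
    (f := fun u ↦ (2 : ℝ) • axisProj k u) (B := fun _ ↦ (2 : ℝ) • axisProj k)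
    (hasFDerivAt_norm_axisProj_sq k) (fun u ↦ (axisProj k).hasFDerivAt.const_smul (2 : ℝ))
    (fun p ↦ by
      refine le_trans ?_ (hx.le_sum_hessian hk p)
      rw [real_inner_smul_left, ← inner_axisProj_axisProj, real_inner_self_eq_norm_sq]
      linarith [hsq p])
    (fun p ↦ by
      rw [← axisDist_eq_norm, ← axisDist_eq_norm, hp₀]
      exact pow_le_pow_left₀ (Real.sqrt_nonneg _) (hconf p) 2) p
  simp only [← axisDist_eq_norm] at h
  rw [← hp₀]
  exact (sq_eq_sq₀ (Real.sqrt_nonneg _) (Real.sqrt_nonneg _)).1 h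

/-- A self-shrinker in a half-space which touches the boundary hyperplane through the origin is
contained in it. -/
theorem IsSelfShrinker.apply_zero_eq_zero {x : S → Euc (m + 1)} (hx : IsSelfShrinker x) (σ : ℝ)
    (hσ : σ ≠ 0) (hconf : ∀ p, σ * x p 0 ≤ 0) {p₀ : S} (hp₀ : x p₀ 0 = 0) (p : S) :
    x p 0 = 0 := by
  set e : Euc (m + 1) := EuclideanSpace.single 0 σ with he
  have hinner : ∀ u : Euc (m + 1), inner ℝ e u = σ * u 0 := fun u ↦ by
    rw [he, EuclideanSpace.inner_single_left]; simp
  -- A linear function has zero Hessian, so the subsolution condition is just the half-space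
  -- condition.
  have h := hx.eq_of_isMax (F := fun u ↦ inner ℝ e u) (p₀ := p₀) (f := fun _ ↦ e) (B := fun _ ↦ 0)
    (fun u ↦ (innerSL ℝ e).hasFDerivAt) (fun u ↦ hasFDerivAt_const e u)
    (fun p ↦ by simpa [hinner] using hconf p)
    (fun p ↦ by simpa [hinner, hp₀] using hconf p) p
  simpa [hinner, hp₀, hσ] using h

theorem IsSelfShrinker.subset_cylinder {x : S → Euc (m + 1)} (hx : IsSelfShrinker x)
    (hk : k ≤ m) (hH : ∀ p, ‖meanCurvature x p‖ ≤ √(k : ℝ)) {R : ℝ} {D : Set (Euc (m + 1))}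
    (hD : IsSolidCylinder k R D) (hconf : range x ⊆ D)
    (htouch : (range x ∩ cylinder m k R).Nonempty) :
    R = √(k : ℝ) ∧ ∀ p, axisDist k (x p) = √(k : ℝ) := by
  obtain ⟨_, ⟨p₀, rfl⟩, hp₀⟩ := htouch
  have hmem : ∀ p, x p ∈ D := fun p ↦ hconf ⟨p, rfl⟩
  rcases hD with rfl | ⟨rfl, rfl, hD⟩
  · have hR := hx.eq_sqrt_of_touch hk hH hmem hp₀
    subst hR
    exact ⟨rfl, hx.axisDist_eq hk hmem hp₀⟩
  · have hp₀' : x p₀ 0 = 0 := by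
      have : axisDist 0 (x p₀) = 0 := hp₀
      rwa [axisDist_zero, abs_eq_zero] at this
    have hzero : ∀ p, x p 0 = 0 := by
      rcases hD with rfl | rfl
      · exact hx.apply_zero_eq_zero (-1) (by norm_num) (fun p ↦ by
          have : 0 ≤ x p 0 := hmem p
          linarith) hp₀'
      · exact hx.apply_zero_eq_zero 1 one_ne_zero (fun p ↦ by
          have : x p 0 ≤ 0 := hmem p
          linarith) hp₀'
    exact ⟨by simp, fun p ↦ by rw [axisDist_zero, hzero]; simp⟩

end Confinement

end SelfShrinker

namespace SelfShrinker

/-! ### Lifting Lipschitz paths -/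

section PathLifting

open Set Filter Topology unitInterval
open scoped NNReal ENNReal

/-- A continuous lift on `[0, t]` of the path `γ` through `f`, starting from `e`. -/
structure IsLiftOn {E X : Type*} [TopologicalSpace E] (f : E → X) (γ : ℝ → X) (e : E) (t : ℝ)
    (Γ : ℝ → E) : Prop where
  continuousOn : ContinuousOn Γ (Icc 0 t)
  lifts : ∀ s ∈ Icc 0 t, f (Γ s) = γ s
  start : Γ 0 = e

theorem IsLiftOn.mono {E X : Type*} [TopologicalSpace E] {f : E → X} {γ : ℝ → X} {e : E}
    {t t' : ℝ} {Γ : ℝ → E} (h : IsLiftOn f γ e t Γ) (ht : t' ≤ t) : IsLiftOn f γ e t' Γ :=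
  ⟨h.continuousOn.mono (Icc_subset_Icc_right ht),
    fun s hs ↦ h.lifts s (Icc_subset_Icc_right ht hs), h.start⟩

theorem IsLiftOn.eqOn {E X : Type*} [TopologicalSpace E] [T2Space E] [TopologicalSpace X]
    {f : E → X} (hf : IsLocalHomeomorph f) {γ : ℝ → X} {e : E} {t : ℝ} {Γ Γ' : ℝ → E}
    (ht : 0 ≤ t) (h : IsLiftOn f γ e t Γ) (h' : IsLiftOn f γ e t Γ') : EqOn Γ Γ' (Icc 0 t) :=
  (T2Space.isSeparatedMap f).eqOn_of_comp_eqOn hf.isLocallyInjective isPreconnected_Icc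
    h.continuousOn h'.continuousOn (fun s hs ↦ (h.lifts s hs).trans (h'.lifts s hs).symm)
    (left_mem_Icc.2 ht) (h.start.trans h'.start.symm)

theorem IsLiftOn.exists_extend {E X : Type*} [TopologicalSpace E] [TopologicalSpace X]
    {f : E → X} (hf : IsLocalHomeomorph f) {γ : ℝ → X} (hγ : Continuous γ) {e : E} {t : ℝ}
    (ht : 0 ≤ t) {Γ : ℝ → E} (h : IsLiftOn f γ e t Γ) :
    ∃ δ > 0, ∃ Γ', IsLiftOn f γ e (t + δ) Γ' := by
  obtain ⟨φ, hφ, rfl⟩ := hf (Γ t)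
  have hγt : γ t ∈ φ.target := by
    rw [← h.lifts t ⟨ht, le_rfl⟩]; exact φ.map_source hφ
  obtain ⟨δ, hδ, hsub⟩ := Metric.nhds_basis_closedBall.mem_iff.1
    (hγ.continuousAt.preimage_mem_nhds (φ.open_target.mem_nhds hγt))
  have hsub' : ∀ s ∈ Icc t (t + δ), γ s ∈ φ.target := fun s hs ↦ hsub (by
    rw [Metric.mem_closedBall, Real.dist_eq, abs_of_nonneg (by linarith [hs.1])]
    linarith [hs.2])
  have hglue : φ.symm (γ t) = Γ t := by
    rw [← h.lifts t ⟨ht, le_rfl⟩, φ.left_inv hφ]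
  refine ⟨δ, hδ, fun s ↦ if s ≤ t then Γ s else φ.symm (γ s), ?_, ?_, ?_⟩
  · rw [← Icc_union_Icc_eq_Icc ht (show t ≤ t + δ by linarith)]
    refine ContinuousOn.union_of_isClosed ?_ ?_ isClosed_Icc isClosed_Icc
    · exact h.continuousOn.congr fun s hs ↦ if_pos hs.2
    · refine (φ.continuousOn_symm.comp hγ.continuousOn hsub').congr fun s hs ↦ ?_
      rcases hs.1.eq_or_lt with rfl | hlt
      · simp [hglue]
      · simp [not_le.2 hlt]
  · intro s hs
    by_cases hst : s ≤ t
    · simpa [hst] using h.lifts s ⟨hs.1, hst⟩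
    · simpa [hst] using φ.right_inv (hsub' s ⟨(not_le.1 hst).le, hs.2⟩)
  · simpa [ht] using h.start

/-- The expansion bound is only local. It propagates by continuous induction to the right along the
interval, since distances on the line add up. -/
theorem IsLiftOn.edist_le {E X : Type*} [PseudoEMetricSpace E] [PseudoEMetricSpace X] {f : E → X}
    {K L : ℝ≥0} (hK : ∀ p, ∀ᶠ q in 𝓝 p, edist p q ≤ K * edist (f p) (f q)) {γ : ℝ → X}
    (hγ : LipschitzWith L γ) {e : E} {t : ℝ} {Γ : ℝ → E} (h : IsLiftOn f γ e t Γ) {s s' : ℝ}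
    (hs : 0 ≤ s) (hss' : s ≤ s') (hs' : s' ≤ t) :
    edist (Γ s) (Γ s') ≤ (K * L : ℝ≥0) * edist s s' := by
  have hsub : Icc s s' ⊆ Icc 0 t := Icc_subset_Icc hs hs'
  have hclosed : IsClosed ({r | edist (Γ s) (Γ r) ≤ (K * L : ℝ≥0) * edist s r} ∩ Icc s s') := by
    have := isClosed_Icc.isClosed_le (s := Icc s s') (f := fun r ↦ edist (Γ s) (Γ r))
      (g := fun r ↦ ((K * L : ℝ≥0) : ℝ≥0∞) * edist s r)
      (continuous_edist.comp_continuousOn (continuousOn_const.prodMk (h.continuousOn.mono hsub)))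
      ((ENNReal.continuous_const_mul ENNReal.coe_ne_top).comp_continuousOn
        (by fun_prop))
    convert this using 1
    ext r
    simp [and_comm]
  refine hclosed.Icc_subset_of_forall_exists_gt (by simp) ?_ (right_mem_Icc.2 hss')
  rintro r ⟨hr, hrs⟩ y hy
  have h1 : Tendsto Γ (𝓝[>] r) (𝓝 (Γ r)) :=
    ((h.continuousOn r (hsub ⟨hrs.1, hrs.2.le⟩)).mono_of_mem_nhdsWithin (by
      refine mem_of_superset (Ioc_mem_nhdsGT hrs.2) fun q hq ↦ hsub ⟨hrs.1.trans hq.1.le, hq.2⟩))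
  obtain ⟨q, hq1, hq2⟩ := ((h1.eventually (hK (Γ r))).and
    (Ioc_mem_nhdsGT (lt_min hy hrs.2))).exists
  have hqs : q ∈ Icc 0 t := hsub ⟨hrs.1.trans hq2.1.le, hq2.2.trans (min_le_right _ _)⟩
  refine ⟨q, ?_, hq2.1, hq2.2.trans (min_le_left _ _)⟩
  rw [h.lifts r (hsub ⟨hrs.1, hrs.2.le⟩), h.lifts q hqs] at hq1
  have h2 : edist (Γ r) (Γ q) ≤ (K * L : ℝ≥0) * edist r q := by
    refine hq1.trans ?_
    rw [ENNReal.coe_mul, mul_assoc]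
    gcongr
    exact hγ r q
  have h3 : edist s q = edist s r + edist r q := by
    rw [edist_dist, edist_dist, edist_dist, ← ENNReal.ofReal_add dist_nonneg dist_nonneg,
      dist_comm s q, dist_comm s r, dist_comm r q, Real.dist_eq, Real.dist_eq, Real.dist_eq,
      abs_of_nonneg (sub_nonneg.2 (hrs.1.trans hq2.1.le)), abs_of_nonneg (sub_nonneg.2 hrs.1),
      abs_of_nonneg (sub_nonneg.2 hq2.1.le)]
    congr 1
    ring
  calc edist (Γ s) (Γ q) ≤ edist (Γ s) (Γ r) + edist (Γ r) (Γ q) := edist_triangle _ _ _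
    _ ≤ (K * L : ℝ≥0) * edist s r + (K * L : ℝ≥0) * edist r q := add_le_add hr h2
    _ = (K * L : ℝ≥0) * edist s q := by rw [h3, mul_add]

/-- The lift on `[0, t)` is Lipschitz, hence Cauchy at `t`; completeness of `E` supplies the
endpoint. -/
theorem exists_isLiftOn_of_forall_lt {E X : Type*} [EMetricSpace E] [CompleteSpace E]
    [EMetricSpace X] {f : E → X} (hf : IsLocalHomeomorph f)
    {K L : ℝ≥0} (hK : ∀ p, ∀ᶠ q in 𝓝 p, edist p q ≤ K * edist (f p) (f q)) {γ : ℝ → X}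
    (hγ : LipschitzWith L γ) {e : E} {t : ℝ} (ht : 0 < t)
    (h : ∀ s ∈ Ico 0 t, ∃ Γ, IsLiftOn f γ e s Γ) : ∃ Γ, IsLiftOn f γ e t Γ := by
  classical
  have h' : ∀ s, ∃ Γ, s ∈ Ico 0 t → IsLiftOn f γ e s Γ := fun s ↦ by
    by_cases hs : s ∈ Ico 0 t
    · obtain ⟨Γ, hΓ⟩ := h s hs
      exact ⟨Γ, fun _ ↦ hΓ⟩
    · exact ⟨fun _ ↦ e, fun h ↦ absurd h hs⟩
  choose G hG using h'
  -- The diagonal choice is consistent by uniqueness of lifts.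
  set Γ : ℝ → E := fun s ↦ G s s with hΓ
  have hagree : ∀ s' ∈ Ico 0 t, EqOn Γ (G s') (Icc 0 s') := fun s' hs' s hs ↦
    (hG s ⟨hs.1, hs.2.trans_lt hs'.2⟩).eqOn hf hs.1 ((hG s' hs').mono hs.2) ⟨hs.1, le_rfl⟩
  have hLip : ∀ s s', 0 ≤ s → s ≤ s' → s' < t →
      edist (Γ s) (Γ s') ≤ (K * L : ℝ≥0) * edist s s' := fun s s' hs hss' hs' ↦ by
    have hs't : s' ∈ Ico 0 t := ⟨hs.trans hss', hs'⟩
    rw [hagree s' hs't ⟨hs, hss'⟩, hagree s' hs't ⟨hs't.1, le_rfl⟩]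
    exact (hG s' hs't).edist_le hK hγ hs hss' le_rfl
  have hLip' : LipschitzOnWith (K * L) Γ (Ico 0 t) := fun s hs s' hs' ↦ by
    rcases le_total s s' with hle | hle
    · exact hLip s s' hs.1 hle hs'.2
    · rw [edist_comm, edist_comm s]
      exact hLip s' s hs'.1 hle hs.2
  have hIco : Ico 0 t ∈ 𝓝[<] t := Ico_mem_nhdsLT ht
  have hcauchy : Cauchy (map Γ (𝓝[<] t)) :=
    (cauchy_nhds.mono nhdsWithin_le_nhds).map_of_le hLip'.uniformContinuousOn
      (le_principal_iff.2 hIco)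
  obtain ⟨ℓ, hℓ⟩ := CompleteSpace.complete hcauchy
  have hℓ' : Tendsto Γ (𝓝[<] t) (𝓝 ℓ) := hℓ
  have hlift : ∀ s ∈ Ico 0 t, f (Γ s) = γ s := fun s hs ↦ (hG s hs).lifts s ⟨hs.1, le_rfl⟩
  refine ⟨Function.update Γ t ℓ, ?_, ?_, ?_⟩
  · intro s hs
    rcases hs.2.eq_or_lt with rfl | hlt
    · rw [continuousWithinAt_update_same]
      refine hℓ'.mono_left (nhdsWithin_mono _ fun r hr ↦ lt_of_le_of_ne hr.1.2 hr.2)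
    · refine ContinuousWithinAt.congr_of_eventuallyEq (f := Γ) ?_ ?_ ?_
      · have h1 : ContinuousWithinAt Γ (Ico 0 t) s :=
          hLip'.continuousOn s ⟨hs.1, hlt⟩
        refine h1.mono_of_mem_nhdsWithin ?_
        filter_upwards [self_mem_nhdsWithin, mem_nhdsWithin_of_mem_nhds (Iio_mem_nhds hlt)]
          with r hr hr' using ⟨hr.1, hr'⟩
      · filter_upwards [mem_nhdsWithin_of_mem_nhds (Iio_mem_nhds hlt)] with r hr
        exact Function.update_of_ne (ne_of_lt hr) _ _
      · exact Function.update_of_ne hlt.ne _ _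
  · intro s hs
    rcases hs.2.eq_or_lt with rfl | hlt
    · rw [Function.update_self]
      have h1 : Tendsto (fun r ↦ f (Γ r)) (𝓝[<] s) (𝓝 (f ℓ)) :=
        (hf.continuous.tendsto ℓ).comp hℓ'
      have h2 : Tendsto (fun r ↦ f (Γ r)) (𝓝[<] s) (𝓝 (γ s)) := by
        refine ((hγ.continuous.tendsto s).mono_left nhdsWithin_le_nhds).congr' ?_
        filter_upwards [hIco] with r hr using (hlift r hr).symm
      exact tendsto_nhds_unique h1 h2
    · rw [Function.update_of_ne hlt.ne]
      exact hlift s ⟨hs.1, hlt⟩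
  · rw [Function.update_of_ne ht.ne]
    exact (hG 0 ⟨le_rfl, ht⟩).start

/-- The times up to which a lift exists form a closed set, by the previous limit argument, and can
always be increased through a local inverse. -/
theorem exists_isLiftOn {E X : Type*} [EMetricSpace E] [CompleteSpace E]
    [EMetricSpace X] {f : E → X} (hf : IsLocalHomeomorph f)
    {K L : ℝ≥0} (hK : ∀ p, ∀ᶠ q in 𝓝 p, edist p q ≤ K * edist (f p) (f q)) {γ : ℝ → X}
    (hγ : LipschitzWith L γ) {e : E} (he : f e = γ 0) {t : ℝ} (ht : 0 ≤ t) :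
    ∃ Γ, IsLiftOn f γ e t Γ := by
  have h0 : ∃ Γ, IsLiftOn f γ e 0 Γ := ⟨fun _ ↦ e, continuousOn_const, fun s hs ↦ by
    rw [le_antisymm hs.2 hs.1, he], rfl⟩
  have hclosed : IsClosed ({s | ∃ Γ, IsLiftOn f γ e s Γ} ∩ Icc 0 t) := by
    rw [← isSeqClosed_iff_isClosed]
    intro u s hu hus
    have hs : s ∈ Icc 0 t := isClosed_Icc.mem_of_tendsto hus (Eventually.of_forall fun n ↦ (hu n).2)
    refine ⟨?_, hs⟩
    rcases hs.1.eq_or_lt with rfl | hpos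
    · exact h0
    refine exists_isLiftOn_of_forall_lt hf hK hγ hpos fun r hr ↦ ?_
    obtain ⟨n, hn⟩ := (hus.eventually (lt_mem_nhds hr.2)).exists
    obtain ⟨Γ, hΓ⟩ := (hu n).1
    exact ⟨Γ, hΓ.mono hn.le⟩
  refine hclosed.Icc_subset_of_forall_exists_gt h0 ?_ (right_mem_Icc.2 ht)
  rintro s ⟨⟨Γ, hΓ⟩, hs⟩ y hy
  obtain ⟨δ, hδ, Γ', hΓ'⟩ := hΓ.exists_extend hf hγ.continuous hs.1
  have hy' : s < y := hy
  refine ⟨min y (s + δ), ⟨Γ', hΓ'.mono (min_le_right _ _)⟩, ?_, min_le_left _ _⟩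
  exact lt_min hy' (by linarith)

/-- Lipschitz paths lift through a local homeomorphism which is locally uniformly expanding and
whose domain is complete. -/
theorem exists_path_lift {E X : Type*} [EMetricSpace E] [CompleteSpace E]
    [EMetricSpace X] {f : E → X} (hf : IsLocalHomeomorph f)
    {K L : ℝ≥0} (hK : ∀ p, ∀ᶠ q in 𝓝 p, edist p q ≤ K * edist (f p) (f q)) {γ : I → X}
    (hγ : LipschitzWith L γ) {e : E} (he : f e = γ 0) :
    ∃ Γ : C(I, E), (∀ t, f (Γ t) = γ t) ∧ Γ 0 = e := by
  have hγ' : LipschitzWith (L * 1) (IccExtend zero_le_one γ) :=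
    hγ.comp (LipschitzWith.projIcc zero_le_one)
  obtain ⟨Γ, hΓ⟩ := exists_isLiftOn hf hK hγ' (e := e) (t := 1)
    (by rw [he, IccExtend_left]; rfl) zero_le_one
  refine ⟨⟨fun t ↦ Γ t, ?_⟩, fun t ↦ ?_, hΓ.start⟩
  · exact hΓ.continuousOn.comp_continuous continuous_subtype_val fun t ↦ t.2
  · have := hΓ.lifts t t.2
    rwa [IccExtend_val] at this

/-! ### Coverings and sections from contractions -/

section Covering

variable {E X : Type*} [TopologicalSpace E] [T2Space E] [TopologicalSpace X] {f : E → X}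

/-- A contraction of `U` to `c` all of whose paths lift through `f`, in both directions. -/
structure IsLiftableContraction (f : E → X) (c : X) (U : Set X) (H : C(I × U, X)) : Prop where
  zero : ∀ u, H (0, u) = c
  one : ∀ u, H (1, u) = u
  lift : ∀ u e, f e = c → ∃ Γ : C(I, E), (∀ t, f (Γ t) = H (t, u)) ∧ Γ 0 = e
  lift_symm : ∀ (u : U) e, f e = u → ∃ Γ : C(I, E), (∀ t, f (Γ t) = H (σ t, u)) ∧ Γ 0 = e

omit [T2Space E] in
theorem discreteTopology_fiber_of_isLocalHomeomorph (hf : IsLocalHomeomorph f) (c : X) :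
    DiscreteTopology (f ⁻¹' {c}) := by
  rw [discreteTopology_iff_isOpen_singleton]
  intro p
  obtain ⟨φ, hφ, rfl⟩ := hf p
  convert φ.open_source.preimage (continuous_subtype_val (p := (· ∈ φ ⁻¹' {c}))) using 1
  ext q
  simp only [mem_singleton_iff, mem_preimage]
  refine ⟨fun h ↦ h ▸ hφ, fun h ↦ Subtype.ext (φ.injOn h hφ ?_)⟩
  have hq : φ q = c := q.2
  have hp : φ p = c := p.2
  rw [hq, hp]

/-- A point over `U` is carried into the fibre over `c` by lifting the reversed contraction path;
lifting the forward path carries it back. Uniqueness of lifts makes these maps mutually inverse, and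
joint continuity of the lifts makes them continuous. -/
theorem IsLiftableContraction.exists_homeomorph (hf : IsLocalHomeomorph f) {c : X} {U : Set X}
    {H : C(I × U, X)} (h : IsLiftableContraction f c U H) :
    ∃ e : f ⁻¹' U ≃ₜ U × (f ⁻¹' {c} : Set E), ∀ p, (e p).1.1 = f p := by
  have hsep := T2Space.isSeparatedMap f
  have huniq : ∀ Γ Γ' : C(I, E), (∀ t, f (Γ t) = f (Γ' t)) → Γ 0 = Γ' 0 → ∀ t, Γ t = Γ' t :=
    fun Γ Γ' h1 h2 t ↦ congrFun (hsep.eq_of_comp_eq hf.isLocallyInjective Γ.continuous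
      Γ'.continuous (funext h1) 0 h2) t
  choose A hA hA0 using fun up : U × (f ⁻¹' {c} : Set E) ↦ h.lift up.1 up.2.1 up.2.2
  choose B hB hB0 using fun q : f ⁻¹' U ↦ h.lift_symm ⟨f q, q.2⟩ q.1 rfl
  have hAc : Continuous fun tu : I × (U × (f ⁻¹' {c} : Set E)) ↦ A tu.2 tu.1 := by
    refine hf.continuous_lift hsep
      (H.comp ⟨fun tu : I × (U × (f ⁻¹' {c} : Set E)) ↦ (tu.1, tu.2.1), by fun_prop⟩)
      (funext fun tu ↦ hA tu.2 tu.1) ?_ fun up ↦ (A up).continuous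
    simp only [hA0]
    fun_prop
  have hBc : Continuous fun tq : I × (f ⁻¹' U) ↦ B tq.2 tq.1 := by
    refine hf.continuous_lift hsep
      (H.comp ⟨fun tq : I × (f ⁻¹' U) ↦ (σ tq.1, ⟨f tq.2, tq.2.2⟩), by
        have := hf.continuous
        fun_prop⟩)
      (funext fun tq ↦ hB tq.2 tq.1) ?_ fun q ↦ (B q).continuous
    simp only [hB0]
    fun_prop
  have hA1 : ∀ up, f (A up 1) = up.1 := fun up ↦ (hA up 1).trans (h.one up.1)
  have hB1 : ∀ q, f (B q 1) = c := fun q ↦ by rw [hB q 1, symm_one, h.zero]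
  have hmem : ∀ up, A up 1 ∈ f ⁻¹' U := fun up ↦ by rw [mem_preimage, hA1]; exact up.1.2
  let symmC : C(I, I) := ⟨σ, continuous_symm⟩
  refine ⟨⟨⟨fun q ↦ (⟨f q, q.2⟩, ⟨B q 1, hB1 q⟩), fun up ↦ ⟨A up 1, hmem up⟩,
    fun q ↦ ?_, fun up ↦ ?_⟩, ?_, ?_⟩, fun p ↦ rfl⟩
  · apply Subtype.ext
    simp only
    set up : U × (f ⁻¹' {c} : Set E) := (⟨f q, q.2⟩, ⟨B q 1, hB1 q⟩) with hup
    have := huniq (A up) ((B q).comp symmC) (fun t ↦ by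
      rw [hA, ContinuousMap.comp_apply, hB]
      simp [symmC, hup]) (by simp [hA0, symmC, hup]) 1
    rw [this]
    simp [symmC, hB0]
  · set q : f ⁻¹' U := ⟨A up 1, hmem up⟩ with hq
    have hfq : (⟨f q, q.2⟩ : U) = up.1 := Subtype.ext (hA1 up)
    refine Prod.ext hfq (Subtype.ext ?_)
    have := huniq (B q) ((A up).comp symmC) (fun t ↦
      (hB q t).trans ((congrArg (fun u ↦ H (σ t, u)) hfq).trans (hA up (σ t)).symm)) (by simp [hB0, symmC, hq]) 1
    refine this.trans ?_
    simp [symmC, hA0]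
  · have h1 : Continuous fun q ↦ B q 1 := hBc.comp (Continuous.prodMk_right 1)
    have := hf.continuous
    simp only
    fun_prop
  · have h1 : Continuous fun up ↦ A up 1 := hAc.comp (Continuous.prodMk_right 1)
    simp only
    fun_prop

theorem isCoveringMap_of_liftableContraction (hf : IsLocalHomeomorph f)
    (h : ∀ c, ∃ U, IsOpen U ∧ c ∈ U ∧ ∃ H : C(I × U, X), IsLiftableContraction f c U H) :
    IsCoveringMap f := by
  intro c
  obtain ⟨U, hU, hc, H, hH⟩ := h c
  obtain ⟨e, he⟩ := hH.exists_homeomorph hf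
  exact ⟨discreteTopology_fiber_of_isLocalHomeomorph hf c, U, hc, hU, hU.preimage hf.continuous,
    e, he⟩

/-- A section over `U` through a given point. -/
theorem IsLiftableContraction.exists_section (hf : IsLocalHomeomorph f) {c : X} {U : Set X}
    {H : C(I × U, X)} (h : IsLiftableContraction f c U H) {p : E} (hp : f p ∈ U) :
    ∃ s : X → E, ContinuousOn s U ∧ (∀ u ∈ U, f (s u) = u) ∧ s (f p) = p := by
  classical
  obtain ⟨e, he⟩ := h.exists_homeomorph hf
  set g : U → E := fun u ↦ e.symm (u, (e ⟨p, hp⟩).2) with hg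
  have hgc : Continuous g := by fun_prop
  refine ⟨fun u ↦ if hu : u ∈ U then g ⟨u, hu⟩ else p, ?_, fun u hu ↦ ?_, ?_⟩
  · rw [continuousOn_iff_continuous_domRestrict]
    refine hgc.congr fun u ↦ ?_
    simp
  · simp only [hu, dif_pos, hg, ← he, Homeomorph.apply_symm_apply]
  · have h1 : (⟨f p, hp⟩ : U) = (e ⟨p, hp⟩).1 := Subtype.ext (he ⟨p, hp⟩).symm
    simp [hp, hg, h1]

/-- A local homeomorphism admitting sections through all points over two open sets with connected
intersection which cover the target is injective. -/
theorem injective_of_sections [PreconnectedSpace E] (hf : IsLocalHomeomorph f) {U : Bool → Set X}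
    (hU : ∀ i, IsOpen (U i)) (hcover : ∀ u, ∃ i, u ∈ U i)
    (hconn : IsConnected (U true ∩ U false))
    (hsec : ∀ i p, f p ∈ U i → ∃ s : X → E, ContinuousOn s (U i) ∧ (∀ u ∈ U i, f (s u) = u) ∧
      s (f p) = p) : Function.Injective f := by
  classical
  have hsep := T2Space.isSeparatedMap f
  obtain ⟨⟨y, hyt, hyf⟩, hpre⟩ := hconn
  have hy : ∀ i, y ∈ U i := fun i ↦ by cases i <;> assumption
  have hinter : ∀ i, U i ∩ U (!i) = U true ∩ U false := fun i ↦ by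
    cases i
    · exact inter_comm _ _
    · rfl
  intro p q hpq
  obtain ⟨i, hi⟩ := hcover (f p)
  obtain ⟨s₁, hs₁, hfs₁, hs₁p⟩ := hsec i p hi
  -- The second section is taken through `s₁ y`, so that both agree at `y` and hence on the
  -- connected intersection.
  obtain ⟨s₂, hs₂, hfs₂, hs₂y⟩ := hsec (!i) (s₁ y) (by rw [hfs₁ y (hy i)]; exact hy _)
  rw [hfs₁ y (hy i)] at hs₂y
  have heq : EqOn s₁ s₂ (U i ∩ U (!i)) := by
    refine hsep.eqOn_of_comp_eqOn hf.isLocallyInjective ((hinter i).symm ▸ hpre)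
      (hs₁.mono inter_subset_left) (hs₂.mono inter_subset_right) (fun u hu ↦ ?_)
      (a := y) ⟨hy _, hy _⟩ hs₂y.symm
    simp only [Function.comp_apply]
    rw [hfs₁ u hu.1, hfs₂ u hu.2]
  set s : X → E := fun u ↦ if u ∈ U i then s₁ u else s₂ u with hs
  have hs1 : EqOn s s₁ (U i) := fun u hu ↦ if_pos hu
  have hs2 : EqOn s s₂ (U (!i)) := fun u hu ↦ by
    by_cases h : u ∈ U i
    · rw [hs1 h, heq ⟨h, hu⟩]
    · exact if_neg h
  have hcov : ∀ u, u ∈ U i ∨ u ∈ U (!i) := fun u ↦ by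
    obtain ⟨j, hj⟩ := hcover u
    cases i <;> cases j <;> simp_all
  have hsc : Continuous s := by
    rw [continuous_iff_continuousAt]
    intro u
    rcases hcov u with hu | hu
    · exact (hs₁.congr hs1).continuousAt ((hU _).mem_nhds hu)
    · exact (hs₂.congr hs2).continuousAt ((hU _).mem_nhds hu)
  have hfs : ∀ u, f (s u) = u := fun u ↦ by
    rcases hcov u with hu | hu
    · rw [hs1 hu, hfs₁ u hu]
    · rw [hs2 hu, hfs₂ u hu]
  -- Both maps lift `f` and agree at `p`, so they agree on the connected space `E`; the global
  -- section is therefore a left inverse.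
  have hid : s ∘ f = id := hsep.eq_of_comp_eq hf.isLocallyInjective (hsc.comp hf.continuous)
    continuous_id (funext fun e ↦ hfs (f e)) p (by simp [hs1 hi, hs₁p])
  have := congrFun hid p
  have h2 := congrFun hid q
  simp only [Function.comp_apply, id] at this h2
  rw [← this, hpq, h2]

end Covering

end PathLifting

end SelfShrinker

namespace SelfShrinker

/-! ### Riemannian and chordal distance -/

section LocalDistance

open Set Filter Topology Metric
open scoped ENNReal

variable {m : ℕ} {S : Type*} [EMetricSpace S] [ChartedSpace (Euc m) S] [IsManifold (𝓡 m) ∞ S]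
  [Bundle.RiemannianBundle (fun p : S ↦ TangentSpace (𝓡 m) p)]

/-- An isometric immersion is locally expanding up to a factor `2`, for the distance of `S` and the
chordal distance. -/
theorem IsIsometricImmersion.eventually_edist_le [IsRiemannianManifold (𝓡 m) S]
    {x : S → Euc (m + 1)} (hx : IsIsometricImmersion x) (p : S) :
    ∀ᶠ q in 𝓝 p, edist p q ≤ 2 * edist (x p) (x q) := by
  set e := extChartAt (𝓡 m) p with he
  set X := localRep x p with hX
  obtain ⟨c, hc, hinj⟩ := hx.exists_antilipschitz_fderiv_localRep p
  have htarget : IsOpen e.target := isOpen_extChartAt_target p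
  obtain ⟨ρ, hρ, hρe, hest⟩ := exists_closedBall_chord_estimates
    ((contDiffAt_localRep hx.smooth p (mem_extChartAt_target p)).of_le ENat.LEInfty.out) hc hinj
    (htarget.mem_nhds (mem_extChartAt_target p))
  have h1 : ContinuousAt e p := continuousAt_extChartAt p
  filter_upwards [h1.preimage_mem_nhds (closedBall_mem_nhds _ hρ),
    extChartAt_source_mem_nhds (I := 𝓡 m) p] with q hq hqs
  -- The Riemannian distance is bounded by the length of the chart segment from `p` to `q`.
  set η : ℝ → Euc m := fun t ↦ e p + t • (e q - e p) with hη
  have hηc : ContDiff ℝ 1 η := by rw [hη]; fun_prop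
  have hηd : ∀ t, HasDerivAt η (e q - e p) t := fun t ↦ by
    have h := ((hasDerivAt_id t).smul_const (e q - e p)).const_add (e p)
    rwa [one_smul] at h
  have hpc : e p ∈ closedBall (e p) ρ := mem_closedBall_self hρ.le
  have hηball : ∀ t ∈ Icc (0 : ℝ) 1, η t ∈ closedBall (e p) ρ := fun t ht ↦
    (convex_closedBall (e p) ρ).add_smul_sub_mem hpc hq ht
  have hp : e.symm (e p) = p := e.left_inv (mem_extChartAt_source p)
  have hq' : e.symm (e q) = q := e.left_inv hqs
  have hsm : ∀ a ∈ e.target, ContMDiffAt 𝓘(ℝ, Euc m) (𝓡 m) 1 e.symm a := fun a ha ↦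
    (contMDiffOn_extChartAt_symm (n := 1) (I := 𝓡 m) p).contMDiffAt (htarget.mem_nhds ha)
  have hle : edist p q ≤ Manifold.pathELength (𝓡 m) (e.symm ∘ η) 0 1 := by
    rw [IsRiemannianManifold.out (I := 𝓡 m) p q]
    refine Manifold.riemannianEDist_le_pathELength ?_ (by simp [hη, hp])
      (by simp [hη, hq']) zero_le_one
    intro t ht
    exact ((hsm _ (hρe (hηball t ht))).comp t hηc.contMDiff.contMDiffAt).contMDiffWithinAt
  refine hle.trans ?_
  rw [Manifold.pathELength_eq_lintegral_mfderiv_Icc]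
  have hbound : ∀ t ∈ Icc (0 : ℝ) 1,
      ‖mfderiv 𝓘(ℝ, ℝ) (𝓡 m) (e.symm ∘ η) t 1‖ₑ ≤ 2 * edist (x p) (x q) := fun t ht ↦ by
    have hat := hρe (hηball t ht)
    have h2 : mfderiv 𝓘(ℝ, ℝ) (𝓡 m) (e.symm ∘ η) t =
        (mfderiv 𝓘(ℝ, Euc m) (𝓡 m) e.symm (η t)).comp (mfderiv 𝓘(ℝ, ℝ) 𝓘(ℝ, Euc m) η t) :=
      mfderiv_comp t ((hsm _ hat).mdifferentiableAt one_ne_zero)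
        (hηc.contMDiff.mdifferentiableAt one_ne_zero)
    have h3 : mfderiv 𝓘(ℝ, ℝ) 𝓘(ℝ, Euc m) η t (1 : ℝ) = e q - e p := by
      rw [mfderiv_eq_fderiv]
      rw [(hηd t).hasFDerivAt.fderiv]
      exact one_smul ℝ _
    have h4 : mfderiv 𝓘(ℝ, ℝ) (𝓡 m) (e.symm ∘ η) t (1 : ℝ) =
        mfderiv 𝓘(ℝ, Euc m) (𝓡 m) e.symm (η t) (e q - e p) :=
      congr($h2 (1 : ℝ)).trans (congrArg (mfderiv 𝓘(ℝ, Euc m) (𝓡 m) e.symm (η t)) h3)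
    have h5 : ‖mfderiv 𝓘(ℝ, Euc m) (𝓡 m) e.symm (η t) (e q - e p)‖ =
        ‖fderiv ℝ X (η t) (e q - e p)‖ := by
      rw [hX, fderiv_localRep_apply hx.smooth p hat]
      exact (hx.norm_differential _ _).symm
    -- The error `c / 4 * ‖e q - e p‖` is at most half the chord, so even the factor `3 / 2` would
    -- do.
    have h6 : ‖fderiv ℝ X (η t) (e q - e p)‖ ≤ 2 * ‖X (e q) - X (e p)‖ := by
      obtain ⟨h7, h8⟩ := hest _ hq _ hpc
      have h9 := h8 _ (hηball t ht)
      have h10 := norm_le_norm_add_norm_sub' (fderiv ℝ X (η t) (e q - e p)) (X (e q) - X (e p))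
      rw [norm_sub_rev _ (X (e q) - X (e p))] at h10
      simp only [← hX] at h7 h9
      have h13 := norm_nonneg (X (e q) - X (e p))
      linarith
    have h11 : X (e q) = x q := by rw [hX, localRep_apply, ← he, hq']
    have h12 : X (e p) = x p := by rw [hX, localRep_apply, ← he, hp]
    rw [h11, h12, ← h5, norm_sub_rev, ← dist_eq_norm] at h6
    calc ‖mfderiv 𝓘(ℝ, ℝ) (𝓡 m) (e.symm ∘ η) t (1 : ℝ)‖ₑ
        = ‖mfderiv 𝓘(ℝ, Euc m) (𝓡 m) e.symm (η t) (e q - e p)‖ₑ := congrArg _ h4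
      _ = ENNReal.ofReal ‖mfderiv 𝓘(ℝ, Euc m) (𝓡 m) e.symm (η t) (e q - e p)‖ :=
        (ofReal_norm _).symm
      _ ≤ ENNReal.ofReal (2 * dist (x p) (x q)) := ENNReal.ofReal_le_ofReal h6
      _ = 2 * edist (x p) (x q) := by
        rw [ENNReal.ofReal_mul zero_le_two, edist_dist]; simp
  calc _ ≤ ∫⁻ _ in Icc (0 : ℝ) 1, 2 * edist (x p) (x q) :=
        MeasureTheory.setLIntegral_mono' measurableSet_Icc hbound
    _ = 2 * edist (x p) (x q) := by simp

end LocalDistance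

/-! ### Local inverses on the cylinder -/

section LocalGraph

open Set Filter Topology

variable {m k : ℕ}

/-- The cylinder is locally a level set of a function `G` with nonvanishing gradient `g`, and is
locally a graph in the direction of the gradient. -/
theorem exists_defining_function {c₀ : Euc (m + 1)} (hc₀ : c₀ ∈ cylinder m k √k) :
    ∃ (G : Euc (m + 1) → ℝ) (g : Euc (m + 1) → Euc (m + 1)) (B : Euc (m + 1) →L[ℝ] Euc (m + 1))
      (M : ℝ) (V : Set (Euc (m + 1))),
      (∀ u, HasFDerivAt G (innerSL ℝ (g u)) u) ∧ HasFDerivAt g B c₀ ∧ g c₀ ≠ 0 ∧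
      (∀ c ∈ cylinder m k √k, G c = M) ∧ IsOpen V ∧ c₀ ∈ V ∧
      ∀ c ∈ cylinder m k √k ∩ V, ∀ c' ∈ cylinder m k √k ∩ V, ∀ t : ℝ, c - c' = t • g c₀ → c = c' := by
  -- For `k = 0` the cylinder is a hyperplane on which `|y|²` has zero gradient, so a coordinate is
  -- used instead.
  rcases Nat.eq_zero_or_pos k with rfl | hk
  · have hmem : ∀ c ∈ cylinder m 0 √(0 : ℕ), c 0 = 0 := fun c hc ↦ by
      have : axisDist 0 c = √(0 : ℕ) := hc
      simpa [axisDist_zero] using this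
    set e : Euc (m + 1) := EuclideanSpace.single 0 1 with he
    have hinner : ∀ u : Euc (m + 1), inner ℝ e u = u 0 := fun u ↦ by
      rw [he, EuclideanSpace.inner_single_left]; simp
    refine ⟨fun u ↦ inner ℝ e u, fun _ ↦ e, 0, 0, univ, fun u ↦ (innerSL ℝ e).hasFDerivAt,
      hasFDerivAt_const _ _, ?_, fun c hc ↦ ?_, isOpen_univ, mem_univ _, ?_⟩
    · simp [he]
    · exact (hinner c).trans (hmem c hc)
    · intro c hc c' hc' t ht
      have h1 := congrArg (fun u : Euc (m + 1) ↦ u 0) ht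
      simp [he, hmem c hc.1, hmem c' hc'.1] at h1
      rw [← sub_eq_zero, ht, ← h1, zero_smul]
  · have hsqrt : 0 < √(k : ℝ) := Real.sqrt_pos.2 (by exact_mod_cast hk)
    have hmem : ∀ c ∈ cylinder m k √k, ‖axisProj k c‖ = √k := fun c hc ↦ by
      rw [← axisDist_eq_norm]; exact hc
    have hne : axisProj k c₀ ≠ 0 := by
      rw [← norm_ne_zero_iff, hmem c₀ hc₀]; exact hsqrt.ne'
    -- `V` is the half-space of points whose `y`-part has positive inner product with that of `c₀`.
    -- It excludes the second intersection of a line in the direction `g c₀` with the cylinder.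
    refine ⟨fun u ↦ ‖axisProj k u‖ ^ 2, fun u ↦ (2 : ℝ) • axisProj k u, (2 : ℝ) • axisProj k,
      √k ^ 2, {u | 0 < inner ℝ (axisProj k c₀) (axisProj k u)}, hasFDerivAt_norm_axisProj_sq k,
      (axisProj k).hasFDerivAt.const_smul (2 : ℝ), smul_ne_zero two_ne_zero hne,
      fun c hc ↦ by simp only [hmem c hc], ?_, ?_, ?_⟩
    · exact isOpen_lt continuous_const (by fun_prop)
    · rw [mem_ofPred_eq, real_inner_self_eq_norm_sq, hmem c₀ hc₀]; positivity
    · intro c hc c' hc' t ht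
      have h1 : axisProj k c - axisProj k c' = (2 * t) • axisProj k c₀ := by
        rw [← map_sub, ht, map_smul, map_smul, axisProj_axisProj, smul_smul, mul_comm]
      have h2 : inner ℝ (axisProj k c - axisProj k c') (axisProj k c + axisProj k c') = (0 : ℝ) := by
        rw [inner_sub_left, inner_add_right, inner_add_right, real_inner_self_eq_norm_sq,
          real_inner_self_eq_norm_sq, hmem c hc.1, hmem c' hc'.1, real_inner_comm]
        ring
      rw [h1, real_inner_smul_left, inner_add_right] at h2
      have h3 : 0 < inner ℝ (axisProj k c₀) (axisProj k c) := hc.2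
      have h4 : 0 < inner ℝ (axisProj k c₀) (axisProj k c') := hc'.2
      have h5 : t = 0 := by
        rcases mul_eq_zero.1 h2 with h | h
        · linarith
        · linarith
      rw [← sub_eq_zero, ht, h5, zero_smul]

variable {S : Type*} [TopologicalSpace S] [ChartedSpace (Euc m) S] [IsManifold (𝓡 m) ∞ S]
  [Bundle.RiemannianBundle (fun p : S ↦ TangentSpace (𝓡 m) p)]

/-- An isometric immersion into the cylinder is a local diffeomorphism onto it. -/
theorem IsIsometricImmersion.exists_local_inverse {x : S → Euc (m + 1)}
    (hx : IsIsometricImmersion x) (hC : ∀ p, x p ∈ cylinder m k √k) (p : S) {W : Set S}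
    (hW : W ∈ 𝓝 p) : ∃ U ⊆ W, IsOpen U ∧ p ∈ U ∧
      (∃ V : Set (Euc (m + 1)), IsOpen V ∧ x '' U = V ∩ cylinder m k √k) ∧
      ∃ s : Euc (m + 1) → S, ContMDiffAt 𝓘(ℝ, Euc (m + 1)) (𝓡 m) ∞ s (x p) ∧
        LeftInvOn s x U := by
  obtain ⟨G, g, B, M, V₀, hG, hg, hg0, hGM, hV₀, hpV₀, hgraph⟩ := exists_defining_function (hC p)
  set e := extChartAt (𝓡 m) p with he
  set X := localRep x p with hX
  set a := e p with ha
  have hat : a ∈ e.target := mem_extChartAt_target p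
  have hXa : X a = x p := localRep_base x p
  have hXs : ContDiffAt ℝ ∞ X a := contDiffAt_localRep hx.smooth p hat
  set A := fderiv ℝ X a with hA
  obtain ⟨c, hc, hAc⟩ := hx.exists_antilipschitz_fderiv_localRep p
  have hAinj : ∀ v, A v = 0 → v = 0 := fun v hv ↦ by
    have := hAc v
    rw [show fderiv ℝ (localRep x p) (extChartAt (𝓡 m) p p) v = 0 from hv, norm_zero] at this
    exact norm_le_zero_iff.1 (by nlinarith)
  -- the gradient of the defining function spans the normal space
  have hperp : ∀ v, inner ℝ (g (x p)) (A v) = 0 := fun v ↦ by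
    have hmax : IsLocalMax (G ∘ X) a := Eventually.of_forall fun b ↦ by
      simp only [Function.comp_apply, hX, localRep_apply]
      rw [hGM _ (hC _), hGM _ (hC _)]
    have := (isLocalMax_comp_line (hXs.of_le ENat.LEInfty.out) hG (by rwa [hXa]) hmax v).1
    rwa [hXa] at this
  have hspan : ∀ w, (∀ v, inner ℝ w (A v) = 0) → ∃ t : ℝ, t • g (x p) = w := fun w hw ↦ by
    have hrank : Module.finrank ℝ (LinearMap.range A.toLinearMap)ᗮ = 1 := by
      have h1 := Submodule.finrank_add_finrank_orthogonal (LinearMap.range A.toLinearMap)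
      have h2 : Module.finrank ℝ (LinearMap.range A.toLinearMap) = m := by
        rw [LinearMap.finrank_range_of_inj ((injective_iff_map_eq_zero _).2 hAinj)]
        simp
      rw [h2] at h1
      simp at h1
      omega
    have hmem : ∀ w, (∀ v, inner ℝ w (A v) = 0) → w ∈ (LinearMap.range A.toLinearMap)ᗮ :=
      fun w hw ↦ by
        rw [Submodule.mem_orthogonal']
        rintro _ ⟨v, rfl⟩
        exact hw v
    have h3 := (finrank_eq_one_iff_of_nonzero' (⟨g (x p), hmem _ hperp⟩ :
      (LinearMap.range A.toLinearMap)ᗮ) (by simpa using hg0)).1 hrank ⟨w, hmem w hw⟩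
    obtain ⟨t, ht⟩ := h3
    exact ⟨t, congrArg Subtype.val ht⟩
  -- The adjoint kills exactly the normal directions, and `L ∘ X` has the invertible derivative `A*
  -- A` at `a`. The inverse function theorem thus gives a local inverse already defined on an
  -- ambient neighbourhood.
  set L := ContinuousLinearMap.adjoint A with hL
  have hLA : Function.Injective (L.comp A).toLinearMap := by
    rw [injective_iff_map_eq_zero]
    intro v hv
    refine hAinj v ?_
    have h1 : inner ℝ (L (A v)) v = 0 := by
      rw [show L (A v) = 0 from hv, inner_zero_left]
    rw [hL, ContinuousLinearMap.adjoint_inner_left] at h1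
    exact inner_self_eq_zero.1 h1
  set T : Euc m ≃L[ℝ] Euc m := (LinearEquiv.ofInjectiveEndo _ hLA).toContinuousLinearEquiv with hT
  have hTLA : (T : Euc m →L[ℝ] Euc m) = L.comp A := by
    ext1 v
    rfl
  have hLX : ContDiffAt ℝ ∞ (L ∘ X) a := L.contDiff.contDiffAt.comp a hXs
  have hderiv : HasFDerivAt (L ∘ X) (T : Euc m →L[ℝ] Euc m) a := by
    rw [hTLA]
    exact L.hasFDerivAt.comp a (hXs.differentiableAt (by simp)).hasFDerivAt
  have hinf : (∞ : ℕ∞ω) ≠ 0 := by simp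
  set ψ := hLX.toOpenPartialHomeomorph (L ∘ X) hderiv hinf with hψ
  have hψcoe : ∀ b, ψ b = L (X b) := fun b ↦ by
    rw [hψ, hLX.toOpenPartialHomeomorph_coe hderiv hinf]; rfl
  have haψ : a ∈ ψ.source := hLX.mem_toOpenPartialHomeomorph_source hderiv hinf
  have hψs : ContDiffAt ℝ ∞ ψ.symm (L (x p)) := by
    have := hLX.to_localInverse hderiv hinf
    rw [← hXa]
    exact this
  have hψa : ψ.symm (L (x p)) = a := by rw [← hXa, ← hψcoe, ψ.left_inv haψ]
  set U : Set S := (e.source ∩ e ⁻¹' ψ.source) ∩ (interior W ∩ x ⁻¹' V₀) with hU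
  have hUo : IsOpen U := by
    refine IsOpen.inter ?_ (isOpen_interior.inter (hV₀.preimage hx.smooth.continuous))
    exact (continuousOn_extChartAt p).isOpen_inter_preimage (isOpen_extChartAt_source p)
      ψ.open_source
  have hpU : p ∈ U := ⟨⟨mem_extChartAt_source p, haψ⟩, mem_interior_iff_mem_nhds.2 hW, hpV₀⟩
  have hxe : ∀ q ∈ e.source, X (e q) = x q := fun q hq ↦ by
    rw [hX, localRep_apply, ← he, e.left_inv hq]
  have hleft : ∀ q ∈ U, ψ.symm (L (x q)) = e q := fun q hq ↦ by
    rw [← hxe q hq.1.1, ← hψcoe, ψ.left_inv hq.1.2]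
  set Q : Set (Euc m) := e.target ∩ e.symm ⁻¹' U with hQ
  have hQo : IsOpen Q := (continuousOn_extChartAt_symm p).isOpen_inter_preimage
    (isOpen_extChartAt_target p) hUo
  refine ⟨U, fun q hq ↦ interior_subset hq.2.1, hUo, hpU,
    ⟨V₀ ∩ L ⁻¹' (ψ.target ∩ ψ.symm ⁻¹' Q), ?_, ?_⟩, fun u ↦ e.symm (ψ.symm (L u)), ?_, ?_⟩
  · exact hV₀.inter ((ψ.isOpen_inter_preimage_symm hQo).preimage L.continuous)
  · ext u
    constructor
    · rintro ⟨q, hq, rfl⟩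
      refine ⟨⟨hq.2.2, ?_, ?_⟩, hC q⟩
      · rw [← hxe q hq.1.1, ← hψcoe]
        exact ψ.map_source hq.1.2
      · rw [mem_preimage, hleft q hq]
        refine ⟨e.map_source hq.1.1, ?_⟩
        rw [mem_preimage, e.left_inv hq.1.1]
        exact hq
    · rintro ⟨⟨hu1, hu2, hu3⟩, hu4⟩
      set q := e.symm (ψ.symm (L u)) with hq
      have hqU : q ∈ U := hu3.2
      have hxq : x q = X (ψ.symm (L u)) := rfl
      have hLq : L (x q) = L u := by rw [hxq, ← hψcoe, ψ.right_inv hu2]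
      -- `u` and `x q` have the same image under `L`, so they differ by a multiple of the normal `g
      -- (x p)`; the graph property makes them equal.
      obtain ⟨t, ht⟩ := hspan (u - x q) fun v ↦ by
        rw [← ContinuousLinearMap.adjoint_inner_left, map_sub, hLq, sub_self, inner_zero_left]
      exact ⟨q, hqU, (hgraph u ⟨hu4, hu1⟩ (x q) ⟨hC q, hqU.2.2⟩ t ht.symm).symm⟩
  · have h1 : ContMDiffAt 𝓘(ℝ, Euc m) (𝓡 m) ∞ e.symm (ψ.symm (L (x p))) := by
      rw [hψa]
      exact (contMDiffOn_extChartAt_symm (n := ∞) (I := 𝓡 m) p).contMDiffAt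
        ((isOpen_extChartAt_target p).mem_nhds hat)
    have h2 : ContDiffAt ℝ ∞ (fun u ↦ ψ.symm (L u)) (x p) :=
      hψs.comp (x p) L.contDiff.contDiffAt
    exact h1.comp (x p) h2.contMDiffAt
  · intro q hq
    simp only
    rw [hleft q hq, e.left_inv hq.1.1]

end LocalGraph

end SelfShrinker

namespace SelfShrinker

/-! ### Contractions and connectedness on the cylinder -/

section CylinderPaths

open Set Filter Topology unitInterval

variable {m k : ℕ}

theorem norm_axisProj_of_mem {c : Euc (m + 1)} (hc : c ∈ cylinder m k √k) :
    ‖axisProj k c‖ = √k := by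
  rw [← axisDist_eq_norm]; exact hc

/-- The radial retraction `(y, z) ↦ (√k y / |y|, z)` onto the cylinder. -/
noncomputable def cylinderRetraction (k : ℕ) (u : Euc (m + 1)) : Euc (m + 1) :=
  u - axisProj k u + (√k * ‖axisProj k u‖⁻¹) • axisProj k u

theorem axisProj_cylinderRetraction (u : Euc (m + 1)) :
    axisProj k (cylinderRetraction k u) = (√k * ‖axisProj k u‖⁻¹) • axisProj k u := by
  rw [cylinderRetraction, map_add, map_sub, map_smul, axisProj_axisProj, sub_self, zero_add]

theorem cylinderRetraction_mem {u : Euc (m + 1)} (hu : k = 0 ∨ axisProj k u ≠ 0) :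
    cylinderRetraction k u ∈ cylinder m k √k := by
  change axisDist k _ = √k
  rw [axisDist_eq_norm, axisProj_cylinderRetraction, norm_smul]
  rcases hu with rfl | hu
  · simp
  · rw [norm_mul, norm_inv, norm_norm, mul_assoc, inv_mul_cancel₀ (norm_ne_zero_iff.2 hu), mul_one,
      Real.norm_of_nonneg (Real.sqrt_nonneg _)]

theorem cylinderRetraction_eq_self {c : Euc (m + 1)} (hc : c ∈ cylinder m k √k) :
    cylinderRetraction k c = c := by
  have h := norm_axisProj_of_mem hc
  rw [cylinderRetraction, h]
  rcases Nat.eq_zero_or_pos k with rfl | hk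
  · simp only [Nat.cast_zero, Real.sqrt_zero, norm_eq_zero] at h
    simp [h]
  · rw [mul_inv_cancel₀ (Real.sqrt_ne_zero'.2 (by exact_mod_cast hk)), one_smul, sub_add_cancel]

theorem contDiffAt_cylinderRetraction {u : Euc (m + 1)} (hu : k = 0 ∨ axisProj k u ≠ 0) :
    ContDiffAt ℝ 1 (cylinderRetraction (m := m) k) u := by
  have hY : ContDiffAt ℝ 1 (fun u : Euc (m + 1) ↦ axisProj k u) u :=
    (axisProj k).contDiff.contDiffAt
  rcases hu with rfl | hu
  · have : cylinderRetraction (m := m) 0 = fun u ↦ u - axisProj 0 u := by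
      ext u
      simp [cylinderRetraction]
    rw [this]
    exact contDiffAt_id.sub hY
  · exact (contDiffAt_id.sub hY).add ((contDiffAt_const.mul
      ((hY.norm ℝ hu).inv (norm_ne_zero_iff.2 hu))).smul hY)

/-- The part of the cylinder which is not antipodal to `c`. -/
def nonAntipodal (k : ℕ) (c : Euc (m + 1)) : Set (cylinder m k √k) :=
  {u | k = 0 ∨ axisProj k (u : Euc (m + 1)) ≠ -axisProj k c}

theorem isOpen_nonAntipodal (c : Euc (m + 1)) : IsOpen (nonAntipodal k c) := by
  have h : IsOpen {u : cylinder m k √k | axisProj k (u : Euc (m + 1)) ≠ -axisProj k c} :=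
    isOpen_ne_fun (by fun_prop) continuous_const
  exact (isOpen_const (p := k = 0)).union h

theorem mem_nonAntipodal_self (c : cylinder m k √k) : c ∈ nonAntipodal k (c : Euc (m + 1)) := by
  rcases Nat.eq_zero_or_pos k with hk | hk
  · exact Or.inl hk
  · refine Or.inr fun h ↦ ?_
    have h1 : axisProj k (c : Euc (m + 1)) = 0 := by
      have h2 : (2 : ℝ) • axisProj k (c : Euc (m + 1)) = 0 := by
        rw [two_smul]; exact eq_neg_iff_add_eq_zero.1 h
      exact (smul_eq_zero.1 h2).resolve_left two_ne_zero
    have h2 := norm_axisProj_of_mem c.2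
    rw [h1, norm_zero] at h2
    exact (Real.sqrt_pos.2 (by exact_mod_cast hk : (0 : ℝ) < k)).ne h2

/-- A segment between vectors `y`, `y'` of equal positive length can pass through `0` only at its
midpoint, and then `y' = -y`. For `k = 0` the retraction is linear and needs no regularity. -/
theorem segment_regular {c : Euc (m + 1)} (hc : c ∈ cylinder m k √k) (u : nonAntipodal k c)
    {t : ℝ} (ht : t ∈ Icc (0 : ℝ) 1) :
    k = 0 ∨ axisProj k (c + t • ((u : cylinder m k √k) - c : Euc (m + 1))) ≠ 0 := by
  rcases Nat.eq_zero_or_pos k with hk | hk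
  · exact Or.inl hk
  refine Or.inr fun h ↦ ?_
  have hpos : 0 < √(k : ℝ) := Real.sqrt_pos.2 (by exact_mod_cast hk)
  set y := axisProj k c with hy
  set y' := axisProj k ((u : cylinder m k √k) : Euc (m + 1)) with hy'
  have h1 : ‖y‖ = √k := norm_axisProj_of_mem hc
  have h2 : ‖y'‖ = √k := norm_axisProj_of_mem u.1.2
  have h3 : (1 - t) • y = -(t • y') := by
    rw [map_add, map_smul, map_sub, ← hy, ← hy'] at h
    rw [eq_neg_iff_add_eq_zero, ← h]
    module
  have h4 : (1 - t) * √k = t * √k := by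
    have := congrArg norm h3
    rwa [norm_neg, norm_smul, norm_smul, h1, h2, Real.norm_of_nonneg (by linarith [ht.2]),
      Real.norm_of_nonneg ht.1] at this
  have h5 : t = 1 / 2 := by
    have := mul_right_cancel₀ hpos.ne' h4
    linarith
  rw [h5] at h3
  have h6 : y' = -y := by
    have h7 : (2 : ℝ) • ((1 - 1 / 2 : ℝ) • y) = (2 : ℝ) • -((1 / 2 : ℝ) • y') := by rw [h3]
    rw [smul_smul, smul_neg, smul_smul] at h7
    norm_num at h7
    rw [h7, neg_neg]
  rcases u.2 with h | h
  · omega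
  · exact h h6

/-- The contraction of the part of the cylinder not antipodal to `c`, along projected segments. -/
noncomputable def cylinderContraction {c : Euc (m + 1)} (hc : c ∈ cylinder m k √k) :
    C(I × nonAntipodal k c, cylinder m k √k) where
  toFun tu := ⟨cylinderRetraction k (c + (tu.1 : ℝ) • ((tu.2 : cylinder m k √k) - c : Euc (m + 1))),
    cylinderRetraction_mem (segment_regular hc tu.2 tu.1.2)⟩
  continuous_toFun := by
    refine Continuous.subtype_mk ?_ _
    rw [continuous_iff_continuousAt]
    intro tu
    exact (contDiffAt_cylinderRetraction (segment_regular hc tu.2 tu.1.2)).continuousAt.comp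
      (f := fun tu : I × nonAntipodal k c ↦
        c + (tu.1 : ℝ) • ((tu.2 : cylinder m k √k) - c : Euc (m + 1))) (by fun_prop)

/-- The paths are `C¹` on a compact interval. The Lipschitz bound is what path lifting requires. -/
theorem exists_lipschitzWith_cylinderContraction {c : Euc (m + 1)} (hc : c ∈ cylinder m k √k)
    (u : nonAntipodal k c) : ∃ L, LipschitzWith L fun t ↦ cylinderContraction hc (t, u) := by
  have h : ContDiffOn ℝ 1 (fun t : ℝ ↦
      cylinderRetraction k (c + t • ((u : cylinder m k √k) - c : Euc (m + 1)))) (Icc 0 1) := by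
    intro t ht
    exact (ContDiffAt.comp (g := cylinderRetraction (m := m) k)
      (f := fun t : ℝ ↦ c + t • ((u : cylinder m k √k) - c : Euc (m + 1))) t
      (contDiffAt_cylinderRetraction (segment_regular hc u ht)) (by fun_prop)).contDiffWithinAt
  obtain ⟨L, hL⟩ := h.exists_lipschitzOnWith one_ne_zero (convex_Icc 0 1) isCompact_Icc
  exact ⟨L, fun t t' ↦ hL t.2 t'.2⟩

theorem isLiftableContraction_cylinderContraction {E : Type*} [EMetricSpace E] [CompleteSpace E]
    {f : E → cylinder m k √k} (hf : IsLocalHomeomorph f) {K : NNReal}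
    (hK : ∀ p, ∀ᶠ q in 𝓝 p, edist p q ≤ K * edist (f p) (f q)) (c : cylinder m k √k) :
    IsLiftableContraction f c (nonAntipodal k c.1) (cylinderContraction c.2) := by
  have h0 : ∀ u, cylinderContraction c.2 (0, u) = c := fun u ↦ by
    apply Subtype.ext
    simp [cylinderContraction, cylinderRetraction_eq_self c.2]
  have h1 : ∀ u, cylinderContraction c.2 (1, u) = u := fun u ↦ by
    apply Subtype.ext
    simp [cylinderContraction, cylinderRetraction_eq_self u.1.2]
  refine ⟨h0, h1, fun u e he ↦ ?_, fun u e he ↦ ?_⟩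
  · obtain ⟨L, hL⟩ := exists_lipschitzWith_cylinderContraction c.2 u
    exact exists_path_lift hf hK hL (by rw [he, h0])
  · obtain ⟨L, hL⟩ := exists_lipschitzWith_cylinderContraction c.2 u
    have hσ : LipschitzWith 1 (σ : I → I) := fun t t' ↦ by
      rw [Subtype.edist_eq, Subtype.edist_eq, coe_symm_eq, coe_symm_eq, edist_sub_left,
        ENNReal.coe_one, one_mul]
    exact exists_path_lift (γ := fun t ↦ cylinderContraction c.2 (σ t, u)) hf hK (hL.comp hσ)
      (by rw [he, symm_zero, h1])

/-- On a cylinder with `k ≥ 1` there are points which are neither equal nor antipodal. -/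
theorem exists_ne_and_ne_neg (hk : 1 ≤ k) (hkm : k ≤ m) (y : Euc (m + 1)) :
    ∃ c ∈ cylinder m k √k, axisProj k c ≠ y ∧ axisProj k c ≠ -y := by
  have hpos : 0 < √(k : ℝ) := Real.sqrt_pos.2 (by exact_mod_cast hk)
  have hb : ∀ i : Fin (m + 1), (i : ℕ) ≤ k →
      axisProj k (EuclideanSpace.single i √(k : ℝ) : Euc (m + 1)) = EuclideanSpace.single i √k :=
    fun i hi ↦ by
      ext j
      rw [axisProj_apply]
      by_cases h : j = i
      · subst h; simp [hi]
      · simp [h]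
  have hmem : ∀ i : Fin (m + 1), (i : ℕ) ≤ k →
      (EuclideanSpace.single i √(k : ℝ) : Euc (m + 1)) ∈ cylinder m k √k := fun i hi ↦ by
    change axisDist k _ = √k
    rw [axisDist_eq_norm, hb i hi, PiLp.norm_single,
      Real.norm_of_nonneg (Real.sqrt_nonneg _)]
  by_contra! hcon
  set i₀ : Fin (m + 1) := 0 with hi₀
  set i₁ : Fin (m + 1) := ⟨1, by omega⟩ with hi₁
  have h01 : i₁ ≠ i₀ := by simp [hi₀, hi₁, Fin.ext_iff]
  -- If `√k e₀` and `√k e₁` were both `±y`, the zeroth coordinate of `y` would be both nonzero and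
  -- zero.
  have key : ∀ i : Fin (m + 1), (i : ℕ) ≤ k → y i ≠ 0 ∧ ∀ j, j ≠ i → y j = 0 := fun i hi ↦ by
    have h := hcon _ (hmem i hi)
    rw [hb i hi] at h
    by_cases hy : (EuclideanSpace.single i √(k : ℝ) : Euc (m + 1)) = y
    · refine ⟨by rw [← hy]; simpa using hpos.ne', fun j hj ↦ by rw [← hy]; simp [hj]⟩
    · have h2 : y = -(EuclideanSpace.single i √(k : ℝ) : Euc (m + 1)) := by rw [h hy, neg_neg]
      refine ⟨by rw [h2]; simpa using hpos.ne', fun j hj ↦ by rw [h2]; simp [hj]⟩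
  exact (key i₀ (Nat.zero_le k)).1 ((key i₁ hk).2 i₀ h01.symm)

/-- For `k ≥ 2` the cylinder stays connected after removing two antipodal fibres. -/
theorem isConnected_nonAntipodal_inter (hk : 2 ≤ k) (hkm : k ≤ m) {c : Euc (m + 1)}
    (hc : c ∈ cylinder m k √k) :
    IsConnected (nonAntipodal k c ∩ nonAntipodal k (-c)) := by
  have hpos : 0 < √(k : ℝ) := Real.sqrt_pos.2 (by exact_mod_cast (by omega : 0 < k))
  set y := axisProj k c with hy
  have hny : ‖y‖ = √k := norm_axisProj_of_mem hc
  -- `W` consists of the points whose `y`-part lies on the line through the two antipodes. Its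
  -- complement is connected in codimension at least `2` and retracts onto the set in question.
  set W : Submodule ℝ (Euc (m + 1)) :=
    (Submodule.span ℝ {y}).comap (axisProj k (m := m)).toLinearMap with hW
  have hmemW : ∀ u, u ∈ W ↔ ∃ t : ℝ, t • y = axisProj k u := fun u ↦ by
    rw [hW, Submodule.mem_comap, Submodule.mem_span_singleton]; rfl
  -- The first three coordinate directions, available since `k ≥ 2`, span a space meeting `W` in at
  -- most a line.
  have hcodim : 1 < Module.rank ℝ (Euc (m + 1) ⧸ W) := by
    set b := (EuclideanSpace.basisFun (Fin (m + 1)) ℝ).toBasis with hb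
    set v : Fin 3 → Euc (m + 1) := fun i ↦ b (Fin.castLE (by omega) i) with hv
    have hli : LinearIndependent ℝ v :=
      b.linearIndependent.comp _ (Fin.castLE_injective _)
    set A := Submodule.span ℝ (range v) with hA
    have hAr : Module.finrank ℝ A = 3 := by
      rw [hA, finrank_span_eq_card hli, Fintype.card_fin]
    have hYA : ∀ u ∈ A, axisProj k u = u := by
      have : A ≤ LinearMap.eqLocus (axisProj k (m := m)).toLinearMap LinearMap.id := by
        rw [hA, Submodule.span_le]
        rintro _ ⟨i, rfl⟩
        change axisProj k (v i) = v i
        ext j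
        rw [axisProj_apply]
        split_ifs with hj
        · rfl
        · have hne : j ≠ Fin.castLE (by omega) i := by
            intro hji
            rw [hji] at hj
            simp at hj
            omega
          simp [hv, hb, hne]
      exact this
    have hinf : Module.finrank ℝ (A ⊓ W : Submodule ℝ (Euc (m + 1))) ≤ 1 := by
      refine (Submodule.finrank_mono (t := Submodule.span ℝ {y}) ?_).trans
        ((finrank_span_le_card _).trans (by simp))
      intro u hu
      obtain ⟨t, ht⟩ := (hmemW u).1 hu.2
      rw [Submodule.mem_span_singleton]
      exact ⟨t, by rw [ht, hYA u hu.1]⟩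
    have h1 := Submodule.finrank_sup_add_finrank_inf_eq A W
    have h2 := Submodule.finrank_le (A ⊔ W)
    have h3 := Submodule.finrank_quotient_add_finrank W
    rw [finrank_euclideanSpace, Fintype.card_fin] at h2 h3
    have h4 : 1 < Module.finrank ℝ (Euc (m + 1) ⧸ W) := by omega
    rw [← Module.finrank_eq_rank]
    exact_mod_cast h4
  have hreg : ∀ u ∉ W, axisProj k u ≠ 0 := fun u hu h0 ↦
    hu ((hmemW u).2 ⟨0, by rw [h0, zero_smul]⟩)
  have himage : ((↑) : cylinder m k √k → Euc (m + 1)) ''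
      (nonAntipodal k c ∩ nonAntipodal k (-c)) = cylinderRetraction k '' (W : Set _)ᶜ := by
    have hk0 : k ≠ 0 := by omega
    ext u
    constructor
    · rintro ⟨u, ⟨h1, h2⟩, rfl⟩
      refine ⟨u, fun hu ↦ ?_, cylinderRetraction_eq_self u.2⟩
      obtain ⟨t, ht⟩ := (hmemW _).1 hu
      have h3 : |t| = 1 := by
        have := congrArg norm ht
        rw [norm_smul, hny, norm_axisProj_of_mem u.2, Real.norm_eq_abs] at this
        exact mul_right_cancel₀ hpos.ne' (this.trans (one_mul _).symm)
      rcases (abs_eq zero_le_one).1 h3 with rfl | rfl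
      · rcases h2 with h2 | h2
        · exact hk0 h2
        · exact h2 (by rw [← ht, map_neg, neg_neg, one_smul])
      · rcases h1 with h1 | h1
        · exact hk0 h1
        · exact h1 (by rw [← ht, neg_one_smul])
    · rintro ⟨u, hu, rfl⟩
      have hu' : ∀ t : ℝ, t • y ≠ axisProj k u := fun t ht ↦ hu ((hmemW u).2 ⟨t, ht⟩)
      have hr := hreg u hu
      have hs : √(k : ℝ) * ‖axisProj k u‖⁻¹ ≠ 0 :=
        mul_ne_zero hpos.ne' (inv_ne_zero (norm_ne_zero_iff.2 hr))
      have hne : ∀ ε : ℝ, axisProj k (cylinderRetraction k u) ≠ ε • y := fun ε h ↦ by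
        rw [axisProj_cylinderRetraction] at h
        refine hu' ((√(k : ℝ) * ‖axisProj k u‖⁻¹)⁻¹ * ε) ?_
        rw [mul_smul, ← h, inv_smul_smul₀ hs]
      refine ⟨⟨_, cylinderRetraction_mem (Or.inr hr)⟩, ⟨Or.inr ?_, Or.inr ?_⟩, rfl⟩
      · have := hne (-1)
        rwa [neg_one_smul] at this
      · have := hne 1
        rwa [one_smul, ← neg_neg y, hy, ← map_neg] at this
  have hconn : IsConnected (cylinderRetraction k '' (W : Set (Euc (m + 1)))ᶜ) :=
    (isConnected_compl_of_one_lt_codim hcodim).image _ fun u hu ↦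
      (contDiffAt_cylinderRetraction (Or.inr (hreg u hu))).continuousAt.continuousWithinAt
  rw [← himage] at hconn
  exact ⟨image_nonempty.1 hconn.1,
    Topology.IsInducing.subtypeVal.isPreconnected_image.1 hconn.2⟩

end CylinderPaths

end SelfShrinker

namespace SelfShrinker

/-! ### The Riemannian covering and the isometry -/

section Covering

open Set Filter Topology unitInterval

variable {m k : ℕ} {S : Type*}

section Topological

variable [TopologicalSpace S] [ChartedSpace (Euc m) S] [IsManifold (𝓡 m) ∞ S]
  [Bundle.RiemannianBundle (fun p : S ↦ TangentSpace (𝓡 m) p)]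

theorem IsIsometricImmersion.isLocalHomeomorph_codRestrict {x : S → Euc (m + 1)}
    (hx : IsIsometricImmersion x) (hC : ∀ p, x p ∈ cylinder m k √k) :
    IsLocalHomeomorph (codRestrict x (cylinder m k √k) hC) := by
  have hcont : Continuous (codRestrict x (cylinder m k √k) hC) :=
    hx.smooth.continuous.codRestrict hC
  have hopen : IsOpenMap (codRestrict x (cylinder m k √k) hC) := by
    refine IsOpenMap.of_nhds_le fun p W hW ↦ ?_
    obtain ⟨U, hUW, -, hpU, ⟨V, hV, hxU⟩, -⟩ := hx.exists_local_inverse hC p hW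
    refine mem_of_superset ((hV.preimage continuous_subtype_val).mem_nhds ?_)
      (fun u hu ↦ ?_ : Subtype.val ⁻¹' V ⊆ W)
    · exact (hxU ▸ mem_image_of_mem x hpU : x p ∈ V ∩ _).1
    · obtain ⟨q, hq, hqu⟩ : (u : Euc (m + 1)) ∈ x '' U := hxU ▸ ⟨hu, u.2⟩
      have : codRestrict x _ hC q = u := Subtype.ext hqu
      exact this ▸ hUW hq
  rw [isLocalHomeomorph_iff_isOpenEmbedding_restrict]
  intro p
  obtain ⟨U, -, hU, hpU, -, s, -, hs⟩ := hx.exists_local_inverse hC p univ_mem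
  refine ⟨U, hU.mem_nhds hpU, .of_continuous_injective_isOpenMap
    (hcont.comp continuous_subtype_val) (fun q q' h ↦ Subtype.ext ?_)
    (hopen.comp hU.isOpenMap_subtype_val)⟩
  exact hs.injOn q.2 q'.2 (congrArg Subtype.val h)

/-- A left inverse over an open set of an immersion into the cylinder is smooth. -/
theorem IsIsometricImmersion.contMDiffOn_leftInverse {x : S → Euc (m + 1)}
    (hx : IsIsometricImmersion x) (hC : ∀ p, x p ∈ cylinder m k √k) {U : Set S} (hU : IsOpen U)
    {s : Euc (m + 1) → S} (hs : LeftInvOn s x U) :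
    ContMDiffOn 𝓘(ℝ, Euc (m + 1)) (𝓡 m) ∞ s (x '' U) := by
  rintro _ ⟨p, hp, rfl⟩
  obtain ⟨U', hU'U, -, hpU', ⟨V, hV, hxU'⟩, s', hs's, hs'⟩ :=
    hx.exists_local_inverse hC p (hU.mem_nhds hp)
  have hxp : x p ∈ V := (hxU' ▸ mem_image_of_mem x hpU' : x p ∈ V ∩ _).1
  refine hs's.contMDiffWithinAt.congr_of_eventuallyEq ?_ ?_
  · filter_upwards [self_mem_nhdsWithin, mem_nhdsWithin_of_mem_nhds (hV.mem_nhds hxp)] with u hu huV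
    obtain ⟨q, hq, rfl⟩ := hu
    obtain ⟨q', hq', hqq⟩ : x q ∈ x '' U' := hxU' ▸ ⟨huV, hC q⟩
    rw [← hqq, hs' hq', hs (hU'U hq')]
  · rw [hs' hpU', hs hp]

/-- A contraction centred at `c` misses the antipodal fibre; a detour through a point that is
neither equal nor antipodal reaches it. Surjectivity follows in two steps. -/
theorem exists_antipodal_chain (hk : k ≤ m) {c c' : Euc (m + 1)} (hc : c ∈ cylinder m k √k)
    (hc' : c' ∈ cylinder m k √k) : ∃ d : cylinder m k √k,
      d ∈ nonAntipodal k c ∧ (⟨c', hc'⟩ : cylinder m k √k) ∈ nonAntipodal k d.1 := by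
  by_cases h : (⟨c', hc'⟩ : cylinder m k √k) ∈ nonAntipodal k c
  · exact ⟨⟨c, hc⟩, mem_nonAntipodal_self ⟨c, hc⟩, h⟩
  · simp only [nonAntipodal, mem_ofPred_eq, not_or, not_not] at h
    obtain ⟨d, hd, h1, h2⟩ := exists_ne_and_ne_neg (Nat.one_le_iff_ne_zero.2 h.1) hk (axisProj k c)
    refine ⟨⟨d, hd⟩, Or.inr h2, Or.inr fun h3 ↦ h1 ?_⟩
    change axisProj k c' = -axisProj k d at h3
    rw [h.2, neg_inj] at h3
    exact h3.symm

end Topological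

variable [EMetricSpace S] [ChartedSpace (Euc m) S] [IsManifold (𝓡 m) ∞ S]
  [Bundle.RiemannianBundle (fun p : S ↦ TangentSpace (𝓡 m) p)] [IsRiemannianManifold (𝓡 m) S]
  [CompleteSpace S]

theorem IsIsometricImmersion.isLiftableContraction {x : S → Euc (m + 1)}
    (hx : IsIsometricImmersion x) (hC : ∀ p, x p ∈ cylinder m k √k) (c : cylinder m k √k) :
    IsLiftableContraction (codRestrict x (cylinder m k √k) hC) c (nonAntipodal k c.1)
      (cylinderContraction c.2) :=
  isLiftableContraction_cylinderContraction (hx.isLocalHomeomorph_codRestrict hC) (K := 2)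
    (fun p ↦ hx.eventually_edist_le p) c

theorem IsIsometricImmersion.isCoveringMap_codRestrict {x : S → Euc (m + 1)}
    (hx : IsIsometricImmersion x) (hC : ∀ p, x p ∈ cylinder m k √k) :
    IsCoveringMap (codRestrict x (cylinder m k √k) hC) :=
  isCoveringMap_of_liftableContraction (hx.isLocalHomeomorph_codRestrict hC) fun c ↦
    ⟨nonAntipodal k c.1, isOpen_nonAntipodal _, mem_nonAntipodal_self c, _,
      hx.isLiftableContraction hC c⟩

theorem IsIsometricImmersion.surjective_codRestrict [Nonempty S] (hk : k ≤ m)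
    {x : S → Euc (m + 1)} (hx : IsIsometricImmersion x) (hC : ∀ p, x p ∈ cylinder m k √k) :
    Function.Surjective (codRestrict x (cylinder m k √k) hC) := by
  have step : ∀ c d : cylinder m k √k, d ∈ nonAntipodal k c.1 →
      c ∈ range (codRestrict x (cylinder m k √k) hC) →
      d ∈ range (codRestrict x (cylinder m k √k) hC) := by
    rintro c d hd ⟨p, hp⟩
    obtain ⟨Γ, hΓ, -⟩ := (hx.isLiftableContraction hC c).lift ⟨d, hd⟩ p hp
    exact ⟨Γ 1, (hΓ 1).trans ((hx.isLiftableContraction hC c).one _)⟩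
  intro c
  obtain ⟨p⟩ := ‹Nonempty S›
  obtain ⟨d, h1, h2⟩ := exists_antipodal_chain hk (hC p) c.2
  exact step d c h2 (step ⟨x p, hC p⟩ d h1 ⟨p, rfl⟩)

/-- The open sets centred at `x p` and `-x p` cover the cylinder and have connected intersection,
and the contractions give sections over each of them. -/
theorem IsIsometricImmersion.injective_of_two_le [PreconnectedSpace S] (hk : 2 ≤ k) (hkm : k ≤ m)
    {x : S → Euc (m + 1)} (hx : IsIsometricImmersion x) (hC : ∀ p, x p ∈ cylinder m k √k) :
    Function.Injective x := by
  intro p p' hpp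
  have hf := hx.isLocalHomeomorph_codRestrict hC
  have hneg : -x p ∈ cylinder m k √k := by
    change axisDist k _ = _
    rw [axisDist_eq_norm, map_neg, norm_neg]
    exact norm_axisProj_of_mem (hC p)
  set c : Bool → cylinder m k √k := fun i ↦ if i then ⟨x p, hC p⟩ else ⟨-x p, hneg⟩ with hc
  refine injective_of_sections hf (U := fun i ↦ nonAntipodal k (c i).1)
    (fun i ↦ isOpen_nonAntipodal _) (fun u ↦ ?_) ?_ (fun i q hq ↦ ?_) (Subtype.ext hpp)
  · by_contra! h
    have h1 := h true
    have h2 := h false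
    simp only [hc, nonAntipodal, mem_ofPred_eq, not_or, not_not, if_true, Bool.false_eq_true,
      if_false, map_neg, neg_neg] at h1 h2
    have h3 := mem_nonAntipodal_self ⟨x p, hC p⟩
    rcases h3 with h3 | h3
    · exact h1.1 h3
    · exact h3 (h2.2.symm.trans h1.2)
  · exact isConnected_nonAntipodal_inter hk hkm (hC p)
  · exact (hx.isLiftableContraction hC (c i)).exists_section hf hq

theorem IsIsometricImmersion.isRiemannianCovering_cylinder [Nonempty S] (hk : k ≤ m)
    {x : S → Euc (m + 1)} (hx : IsIsometricImmersion x) (hC : ∀ p, x p ∈ cylinder m k √k) :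
    IsRiemannianCovering x (cylinder m k √k) where
  immersion := hx
  range_eq := by
    refine (range_subset_iff.2 hC).antisymm fun c hc ↦ ?_
    obtain ⟨p, hp⟩ := hx.surjective_codRestrict hk hC ⟨c, hc⟩
    exact ⟨p, congrArg Subtype.val hp⟩
  covering := hx.isCoveringMap_codRestrict hC
  local_diffeo p := by
    obtain ⟨U, -, hU, hpU, hV, s, -, hs⟩ := hx.exists_local_inverse hC p univ_mem
    exact ⟨U, hU, hpU, hV, s, hx.contMDiffOn_leftInverse hC hU hs, hs⟩

theorem IsIsometricImmersion.isRiemannianIsometry_cylinder [ConnectedSpace S] (hk : 2 ≤ k)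
    (hkm : k ≤ m) {x : S → Euc (m + 1)} (hx : IsIsometricImmersion x)
    (hC : ∀ p, x p ∈ cylinder m k √k) : IsRiemannianIsometry x (cylinder m k √k) where
  immersion := hx
  range_eq := (hx.isRiemannianCovering_cylinder hkm hC).range_eq
  smooth_inverse := by
    have hs := Function.leftInverse_invFun (hx.injective_of_two_le hk hkm hC)
    refine ⟨Function.invFun x, ?_, hs⟩
    rw [← (hx.isRiemannianCovering_cylinder hkm hC).range_eq, ← image_univ]
    exact hx.contMDiffOn_leftInverse hC isOpen_univ fun p _ ↦ hs p

end Covering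

end SelfShrinker

theorem mainTheorem3 {m k : ℕ} (hk : k ≤ m)
    {S : Type*} [EMetricSpace S] [ChartedSpace (SelfShrinker.Euc m) S] [IsManifold (𝓡 m) ∞ S]
    [Bundle.RiemannianBundle (fun p : S ↦ TangentSpace (𝓡 m) p)]
    [IsContMDiffRiemannianBundle (𝓡 m) ∞ (SelfShrinker.Euc m)
      (fun p : S ↦ TangentSpace (𝓡 m) p)]
    [IsRiemannianManifold (𝓡 m) S] [CompleteSpace S]
    (x : S → SelfShrinker.Euc (m + 1)) (hx : SelfShrinker.IsSelfShrinker x)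
    (hH : ∀ p, ‖SelfShrinker.meanCurvature x p‖ ≤ √(k : ℝ))
    (R : ℝ) (D : Set (SelfShrinker.Euc (m + 1))) (hD : SelfShrinker.IsSolidCylinder k R D)
    (hconf : Set.range x ⊆ D)
    (htouch : (Set.range x ∩ SelfShrinker.cylinder m k R).Nonempty) :
    R = √(k : ℝ) ∧
      SelfShrinker.IsRiemannianCovering x (SelfShrinker.cylinder m k √(k : ℝ)) ∧
      (2 ≤ k → SelfShrinker.IsRiemannianIsometry x (SelfShrinker.cylinder m k √(k : ℝ))) := by
  have := hx.connected
  obtain ⟨hR, hC⟩ := hx.subset_cylinder hk hH hD hconf htouch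
  exact ⟨hR, hx.immersion.isRiemannianCovering_cylinder hk hC,
    fun hk2 ↦ hx.immersion.isRiemannianIsometry_cylinder hk2 hk hC⟩
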